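/- Let $\xi$ be a random variable, let $f(\cdot;\xi):\mathbb{R}^d\to\mathbb{R}$ be integrable in $\xi$ at every point, and let $F(w)=\mathbb{E}[f(w;\xi)]$. Assume that $F$ is $\mu$-strongly convex, i.e. $F(w)-F(w')\ge\langle\nabla F(w'),w-w'\rangle+\frac{\mu}{2}\|w-w'\|^2$ for all $w,w'$, with $\mu>0$; and that for every realization of $\xi$ the function $f(\cdot;\xi)$ is convex and $L$-smooth (differentiable with $L$-Lipschitz gradient, $L>0$). Let $w_*$ be the minimizer of $F$ and assume that $N=2\,\mathbb{E}[\|\nabla f(w_*;\xi)\|^2]$ is finite. Let $D_\xi\subseteq\{1,\dots,d\}$ be the set of positions that are non-zero in $\nabla f(w;\xi)$ for at least one $w$. Fix an integer $D\ge1$. For each $\xi$ let $D_\xi$ be partitioned into $d_\xi=\min\{D,|D_\xi|\}$ non-empty sets $S^\xi_u$, each of size $\lfloor|D_\xi|/D\rfloor$ or $\lceil|D_\xi|/D\rceil$ (measurably in $\xi$); $S^\xi_u$ also denotes the diagonal $0/1$-matrix with ones at the positions in the set. Put $\bar\Delta_D=D\cdot\mathbb{E}[\lceil|D_\xi|/D\rceil]$.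 Let $\tau\ge 0$ be an integer and consider the Hogwild! recursion $$w_{t+1}=w_t-\eta_t\,d_{\xi_t}S^{\xi_t}_{u_t}\nabla f(\hat w_t;\xi_t),\qquad t\ge0,$$ $$\hat w_t=w_{t-\tau}-\sum_{j=t-\tau}^{t-1}\eta_j\,d_{\xi_j}\Sigma_{t,j}S^{\xi_j}_{u_j}\nabla f(\hat w_j;\xi_j)$$ (shared memory consistent with delay $\tau$), where $t-\tau$ means $\max\{t-\tau,0\}$, the masks $\Sigma_{t,j}$ are arbitrary, possibly random, diagonal $0/1$-matrices, and $\mathbb{E}\|w_0-w_*\|^2<\infty$. After $\hat w_t$ has been read, $\xi_t$ is drawn with the law of $\xi$, independently of $w_0$, of all earlier draws and of all masks used up to and including the read $\hat w_t$; given all of this and $\xi_t$, the set $S^{\xi_t}_{u_t}$ is chosen uniformly among the sets partitioning $D_{\xi_t}$ (if $D_{\xi_t}=\emptyset$, no entry is updated). Let $$\eta_t=\frac{\alpha_t}{\mu(t+E)},\qquad 4\le\alpha_t\le\alpha,\qquad E=\max\Big\{2\tau,\frac{4L\alpha D}{\mu}\Big\}.$$ Then $\mathbb{E}[\|\hat w_t-w_*\|^2]$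 and $\mathbb{E}[\|w_t-w_*\|^2]$ are finite for all $t$, and for all $t\ge2$ both are at most $$\frac{4\alpha^2DN}{\mu^2}\,\frac{t}{(t+E-1)^2}+C\,\frac{\ln t}{(t+E-1)^2},$$ where the constant $C$ depends only on $\mu,L,\alpha,N,D,\tau$ and an upper bound on $\mathbb{E}\|w_0-w_*\|^2$. Moreover, the expected number of single vector entry updates during the first $t$ iterations equals $t\,\mathbb{E}[|D_\xi|/\min\{D,|D_\xi|\}]$ (with $0/0=0$) and is at most $t'=t\,\bar\Delta_D/D$; for $t\ge1$ it equals $t'$ if and only if almost surely $|D_\xi|\le D$ or $D$ divides $|D_\xi|$ (in particular if $D=1$ or $D=\max_\xi|D_\xi|$). -/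

import Mathlib

open MeasureTheory ProbabilityTheory

universe u v

noncomputable section

/-- The parameter space `ℝ^d` with its Euclidean norm. -/
abbrev Vec (d : ℕ) : Type := EuclideanSpace ℝ (Fin d)

/-- `g` is differentiable and its gradient is `L`-Lipschitz. -/
def IsLSmooth {d : ℕ} (L : ℝ) (g : Vec d → ℝ) : Prop :=
  Differentiable ℝ g ∧ ∀ w w' : Vec d, ‖gradient g w - gradient g w'‖ ≤ L * ‖w - w'‖

/-- First-order `μ`-strong convexity. With `μ = 0` this is first-order convexity. -/
def IsFirstOrderConvex {d : ℕ} (μ : ℝ) (g : Vec d → ℝ) : Prop :=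
  ∀ w w' : Vec d, inner ℝ (gradient g w') (w - w') + μ / 2 * ‖w - w'‖ ^ 2 ≤ g w - g w'

/-- The expected risk `F(w) = 𝔼[f(w;ξ)]`, where `ξ` has law `ν`. -/
def risk {d : ℕ} {Ξ : Type u} [MeasurableSpace Ξ] (ν : Measure Ξ) (f : Vec d → Ξ → ℝ)
    (w : Vec d) : ℝ :=
  ∫ ξ, f w ξ ∂ν

/-- The stochastic gradient `∇f(w;ξ)` (with respect to `w`). -/
def stochGrad {d : ℕ} {Ξ : Type u} (f : Vec d → Ξ → ℝ) (w : Vec d) (ξ : Ξ) : Vec d :=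
  gradient (fun w' => f w' ξ) w

open Classical in
/-- `D_ξ`: the positions that are non-zero in `∇f(w;ξ)` for at least one `w`. -/
def gradSupport {d : ℕ} {Ξ : Type u} (f : Vec d → Ξ → ℝ) (ξ : Ξ) : Finset (Fin d) :=
  Finset.univ.filter fun i => ∃ w : Vec d, stochGrad f w ξ i ≠ 0

/-- `Δ̄_D = D · 𝔼[⌈|D_ξ| / D⌉]`. -/
def deltaBar {d : ℕ} {Ξ : Type u} [MeasurableSpace Ξ] (ν : Measure Ξ) (f : Vec d → Ξ → ℝ)
    (D : ℕ) : ℝ :=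
  D * ∫ ξ, (⌈((gradSupport f ξ).card : ℝ) / D⌉₊ : ℝ) ∂ν

/-- The action of the diagonal 0/1-matrix whose ones are at the positions in `s`. -/
def filterVec {d : ℕ} (s : Finset (Fin d)) (v : Vec d) : Vec d :=
  WithLp.toLp 2 fun i => if i ∈ s then v i else 0

/-- For every `ξ` the non-empty sets `S^ξ_u` partition `D_ξ` into `D` approximately equally sized
sets, i.e. of size `⌊|D_ξ|/D⌋` or `⌈|D_ξ|/D⌉`; if `D > |D_ξ|`, there are `|D_ξ|` singletons.
The partition depends measurably on `ξ`. -/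
structure IsFilterPartition {d : ℕ} {Ξ : Type u} [MeasurableSpace Ξ] (f : Vec d → Ξ → ℝ) (D : ℕ)
    (part : (ξ : Ξ) → Finpartition (gradSupport f ξ)) : Prop where
  card_parts : ∀ ξ, (part ξ).parts.card = min D (gradSupport f ξ).card
  card_part : ∀ ξ, ∀ s ∈ (part ξ).parts,
    s.card = ⌊((gradSupport f ξ).card : ℝ) / D⌋₊ ∨ s.card = ⌈((gradSupport f ξ).card : ℝ) / D⌉₊
  measurable : ∀ s : Finset (Fin d), MeasurableSet {ξ | s ∈ (part ξ).parts}

/-- The aggregate that iteration `j` subtracts from shared memory,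
`η_j d_{ξ_j} S^{ξ_j}_{u_j} ∇f(ŵ_j;ξ_j)`, where `d_ξ` is the number of sets partitioning `D_ξ`,
`s` is the selected set `S^{ξ_j}_{u_j}` and `v` is the read vector `ŵ_j`. -/
def hogwildUpdate {d : ℕ} {Ξ : Type u} (f : Vec d → Ξ → ℝ)
    (part : (ξ : Ξ) → Finpartition (gradSupport f ξ)) (η : ℝ) (x : Ξ) (s : Finset (Fin d))
    (v : Vec d) : Vec d :=
  (η * ((part x).parts.card : ℝ)) • filterVec s (stochGrad f v x)

/-- A run of the general Hogwild! recursion with shared memory that is consistent with delay `τ`.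
`ξ t` is the sample, `S t` the selected set of positions, `w t` the iterate and `what t` the vector
read from shared memory. `ℱ t` is the information available when the read `what t` has been made and
before `ξ t` and `S t` are drawn. `M t j` is the set of positions whose updates made from `what j`
are included in `what t`. -/
structure IsHogwildRun {d : ℕ} {Ξ : Type u} [MeasurableSpace Ξ] (ν : Measure Ξ)
    (f : Vec d → Ξ → ℝ) (part : (ξ : Ξ) → Finpartition (gradSupport f ξ)) (τ : ℕ) (η : ℕ → ℝ)
    {Ω : Type v} [mΩ : MeasurableSpace Ω] (P : Measure Ω) (ℱ : Filtration ℕ mΩ)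
    (ξ : ℕ → Ω → Ξ) (S : ℕ → Ω → Finset (Fin d)) (M : ℕ → ℕ → Ω → Finset (Fin d))
    (w what : ℕ → Ω → Vec d) : Prop where
  measurable_init : Measurable[ℱ 0] (w 0)
  measurable_sample : ∀ t, Measurable[ℱ (t + 1)] (ξ t)
  measurable_filter : ∀ t i, MeasurableSet[ℱ (t + 1)] {ω | i ∈ S t ω}
  measurable_mask : ∀ t j i, MeasurableSet[ℱ t] {ω | i ∈ M t j ω}
  /-- each sample has law `ν` -/
  law_sample : ∀ t, P.map (ξ t) = ν
  /-- each sample is independent of the past and of the current read -/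
  indep_sample : ∀ t, Indep (MeasurableSpace.comap (ξ t) inferInstance) (ℱ t) P
  /-- Given the past and `ξ t`, the set `S t` is uniformly distributed on the sets that partition
  `D_{ξ t}`. Where `D_{ξ t}` is empty there is no such set; the condition then says that `S t` is
  almost surely empty: no entry is updated. -/
  uniform_filter : ∀ t, ∀ s : Finset (Fin d), s.Nonempty →
    P[Set.indicator {ω | S t ω = s} (fun _ => (1 : ℝ)) |
        ℱ t ⊔ MeasurableSpace.comap (ξ t) inferInstance]
      =ᵐ[P] fun ω =>
        if s ∈ (part (ξ t ω)).parts then (((part (ξ t ω)).parts.card : ℝ))⁻¹ else 0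
  /-- the general recursion -/
  step : ∀ t ω, w (t + 1) ω = w t ω - hogwildUpdate f part (η t) (ξ t ω) (S t ω) (what t ω)
  /-- The read vector is `w_{t-τ}` plus some of the single-entry updates made from then on.
  Truncated subtraction gives the convention `t - τ = max(t - τ, 0)`. -/
  read : ∀ t ω, what t ω = w (t - τ) ω - ∑ j ∈ Finset.Ico (t - τ) t,
    filterVec (M t j ω) (hogwildUpdate f part (η j) (ξ j ω) (S j ω) (what j ω))

/-- `E = max {2τ, 4LαD/μ}`. -/
def stepShift (μ L α : ℝ) (D τ : ℕ) : ℝ := max (2 * (τ : ℝ)) (4 * L * α * D / μ)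

/-- `(4α²DN/μ²) · t/(t+E-1)² + C · ln t/(t+E-1)²`. -/
def hogwildBound (μ L α N : ℝ) (D τ : ℕ) (C : ℝ) (t : ℕ) : ℝ :=
  4 * α ^ 2 * D * N / μ ^ 2 * (t / (t + stepShift μ L α D τ - 1) ^ 2)
    + C * (Real.log t / (t + stepShift μ L α D τ - 1) ^ 2)

end

/-! Let `Y t`, `Z t`, `X t` be the mean squares of `w t - wstar`, `what t - wstar`, `w t - what t`.
The factor `d_ξ` makes the filtered gradient unbiased (`sum_parts_inner_hogwildUpdate`), and since
the parts are disjoint the second moment grows only by a factor `D`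
(`sum_parts_norm_hogwildUpdate_sq_le`).

Expanding `‖w (t+1) - wstar‖ ^ 2` and averaging over the filter and the fresh sample leaves an inner
product with `∇F (what t)` and a second moment. Strong convexity bounds the inner product with a
gain of twice the risk gap at `what t`. One copy of the gap pays for replacing `what t` by `w t`,
the other for the second moment, because `4LDη ≤ 1` (`descent_inequality`). The result is `Y (t+1) ≤
(1 - 2/(t+E)) Y t + c₁/(t+E) X t + A/(t+E)²` with `A = (α/μ)² D N`.

The discrepancy `X t` consists of at most `τ` recent updates, each of mean square `O(1/(t+E)²)`
provided `Z` is bounded. Boundedness is a bootstrap: for large `t` the contraction beats both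
perturbations (`exists_bound`). Then `X t = O(1/(t+E)²)`, and multiplying the recursion by `(t+E)²`
makes it telescope to `A t + O(ln t)` (`sq_mul_le`, `exists_rate`).

The update count is a separate computation: a uniformly chosen part has mean size `|D_ξ|` divided by
the number of parts. -/

/-! ### Smooth convex functions. -/

theorem hasDerivAt_comp_line {d : ℕ} {g : Vec d → ℝ} (hg : Differentiable ℝ g) (w u : Vec d)
    (s : ℝ) : HasDerivAt (fun s : ℝ => g (w + s • u)) (inner ℝ (gradient g (w + s • u)) u) s := by
  have h1 : HasDerivAt (fun s : ℝ => w + s • u) u s := by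
    simpa using ((hasDerivAt_id s).smul_const u).const_add w
  have h2 := (hg (w + s • u)).hasFDerivAt.comp_hasDerivAt s h1
  rwa [← inner_gradient_left] at h2

/-- Along the segment from `w` to `w + u`, the function minus its quadratic upper model has
nonpositive derivative, by Cauchy–Schwarz and the Lipschitz bound, so comparing the endpoints
suffices. -/
theorem IsLSmooth.le_add_sq {d : ℕ} {L : ℝ} {g : Vec d → ℝ} (hg : IsLSmooth L g) (w u : Vec d) :
    g (w + u) ≤ g w + inner ℝ (gradient g w) u + L / 2 * ‖u‖ ^ 2 := by
  have hd : ∀ s : ℝ, HasDerivAt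
      (fun s : ℝ => g (w + s • u) - s * inner ℝ (gradient g w) u - L / 2 * ‖u‖ ^ 2 * s ^ 2)
      (inner ℝ (gradient g (w + s • u)) u - inner ℝ (gradient g w) u
        - L / 2 * ‖u‖ ^ 2 * (2 * s)) s := by
    intro s
    have h2 : HasDerivAt (fun s : ℝ => s ^ 2) (2 * s) s := by simpa using hasDerivAt_pow 2 s
    have h3 := (hasDerivAt_id s).mul_const (inner ℝ (gradient g w) u)
    rw [one_mul] at h3
    exact ((hasDerivAt_comp_line hg.1 w u s).sub h3).sub (h2.const_mul (L / 2 * ‖u‖ ^ 2))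
  have hanti := antitoneOn_of_deriv_nonpos (convex_Icc (0 : ℝ) 1)
    (fun s _ => (hd s).continuousAt.continuousWithinAt)
    (fun s _ => (hd s).differentiableAt.differentiableWithinAt) (by
      intro s hs
      rw [(hd s).deriv, ← inner_sub_left]
      rw [interior_Icc] at hs
      have h1 := real_inner_le_norm (gradient g (w + s • u) - gradient g w) u
      have h2 := hg.2 (w + s • u) w
      rw [add_sub_cancel_left, norm_smul, Real.norm_of_nonneg hs.1.le] at h2
      nlinarith [mul_le_mul_of_nonneg_right h2 (norm_nonneg u)])
  have := hanti (Set.left_mem_Icc.2 zero_le_one) (Set.right_mem_Icc.2 zero_le_one) zero_le_one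
  simp only [one_smul, one_mul, one_pow, mul_one, zero_smul, add_zero, zero_mul, ne_eq,
    OfNat.ofNat_ne_zero, not_false_eq_true, zero_pow, mul_zero, sub_zero] at this
  linarith

/-- Compare two bounds at the gradient-step point `v - r / L`, with `r` the gradient difference:
smoothness at `v` bounds the value above, convexity at `w` bounds it below. -/
theorem IsFirstOrderConvex.norm_gradient_sub_sq_le {d : ℕ} {L : ℝ} {g : Vec d → ℝ} (hL : 0 < L)
    (hc : IsFirstOrderConvex 0 g) (hg : IsLSmooth L g) (v w : Vec d) :
    ‖gradient g v - gradient g w‖ ^ 2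
      ≤ 2 * L * (g v - g w - inner ℝ (gradient g w) (v - w)) := by
  set r := gradient g v - gradient g w with hr
  have h1 := hg.le_add_sq v (-(1 / L) • r)
  have h2 := hc (v + -(1 / L) • r) w
  rw [norm_smul, inner_smul_right] at h1
  have h3 : v + -(1 / L) • r - w = (v - w) + -(1 / L) • r := by abel
  rw [h3, inner_add_right, inner_smul_right] at h2
  have h4 : inner ℝ (gradient g v) r - inner ℝ (gradient g w) r = ‖r‖ ^ 2 := by
    rw [← inner_sub_left, ← hr, real_inner_self_eq_norm_sq]
  rw [Real.norm_eq_abs, mul_pow, sq_abs] at h1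
  have h5 : (1 / L) * ‖r‖ ^ 2 - L / 2 * ((-(1 / L)) ^ 2 * ‖r‖ ^ 2)
      ≤ g v - g w - inner ℝ (gradient g w) (v - w) := by
    rw [← h4]
    rw [← h4] at h1
    linarith
  have h6 : (1 / L) * ‖r‖ ^ 2 - L / 2 * ((-(1 / L)) ^ 2 * ‖r‖ ^ 2) = ‖r‖ ^ 2 / (2 * L) := by
    field_simp
    ring
  rw [h6, div_le_iff₀ (by positivity)] at h5
  linarith

theorem IsFirstOrderConvex.mono {d : ℕ} {μ μ' : ℝ} {g : Vec d → ℝ} (h : μ' ≤ μ)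
    (hc : IsFirstOrderConvex μ g) : IsFirstOrderConvex μ' g := by
  intro w w'
  have := hc w w'
  nlinarith [sq_nonneg ‖w - w'‖, mul_le_mul_of_nonneg_right h (sq_nonneg ‖w - w'‖)]

/-! ### Measurability of the stochastic gradient. -/

section Measurability

variable {d : ℕ} {Ξ : Type u} {f : Vec d → Ξ → ℝ} {L : ℝ}

theorem stochGrad_sub_le (hs : ∀ x, IsLSmooth L (fun v => f v x)) (v w : Vec d) (x : Ξ) :
    ‖stochGrad f v x - stochGrad f w x‖ ≤ L * ‖v - w‖ := (hs x).2 v w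

theorem continuous_stochGrad (hs : ∀ x, IsLSmooth L (fun v => f v x)) (x : Ξ) :
    Continuous fun v => stochGrad f v x := by
  refine (LipschitzWith.of_dist_le_mul (K := L.toNNReal) fun v w => ?_).continuous
  rw [dist_eq_norm, dist_eq_norm]
  exact (stochGrad_sub_le hs v w x).trans
    (mul_le_mul_of_nonneg_right (Real.le_coe_toNNReal L) (norm_nonneg _))

variable [MeasurableSpace Ξ]

theorem measurable_stochGrad (hm : ∀ v, Measurable (f v))
    (hs : ∀ x, IsLSmooth L (fun v => f v x)) (v : Vec d) : Measurable (stochGrad f v) := by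
  have key : ∀ i, Measurable fun x => stochGrad f v x i := by
    intro i
    -- Each coordinate is the limit of difference quotients with step `1 / (n + 1)`, which are
    -- measurable in `x`.
    let u : Vec d := EuclideanSpace.single i 1
    refine measurable_of_tendsto_metrizable
      (f := fun (n : ℕ) x => (n + 1 : ℝ) * (f (v + (1 / (n + 1 : ℝ)) • u) x - f v x))
      (fun n => ((hm _).sub (hm _)).const_mul _) (tendsto_pi_nhds.2 fun x => ?_)
    have h := (hasDerivAt_comp_line (hs x).1 v u 0).tendsto_slope_zero_right
    have h1 : Filter.Tendsto (fun n : ℕ => 1 / ((n : ℝ) + 1)) Filter.atTop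
        (nhdsWithin 0 (Set.Ioi 0)) :=
      tendsto_nhdsWithin_iff.2 ⟨tendsto_one_div_add_atTop_nhds_zero_nat,
        Filter.Eventually.of_forall fun n => Set.mem_Ioi.2 (by positivity)⟩
    have h2 := h.comp h1
    have h3 : inner ℝ (gradient (fun w' => f w' x) (v + (0 : ℝ) • u)) u = stochGrad f v x i := by
      rw [zero_smul, add_zero, EuclideanSpace.inner_single_right]
      simp [stochGrad]
    rw [h3] at h2
    refine h2.congr fun n => ?_
    simp [Function.comp]
  exact (WithLp.measurable_toLp 2 _).comp (measurable_pi_iff.2 key)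

theorem measurable_uncurry_stochGrad (hm : ∀ v, Measurable (f v))
    (hs : ∀ x, IsLSmooth L (fun v => f v x)) :
    Measurable fun p : Vec d × Ξ => stochGrad f p.1 p.2 :=
  measurable_uncurry_of_continuous_of_measurable (u := fun v x => stochGrad f v x)
    (continuous_stochGrad hs) (measurable_stochGrad hm hs)

end Measurability

/-! ### Averages over one sample and the one-step estimate. -/

section Risk

variable {d : ℕ} {Ξ : Type u} {f : Vec d → Ξ → ℝ} {L : ℝ} [MeasurableSpace Ξ]
  {ν : Measure Ξ}

theorem integrable_bregman (hi : ∀ v, Integrable (f v) ν)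
    {v : Vec d} (hgi : Integrable (stochGrad f v) ν) (w u : Vec d) :
    Integrable (fun x => f w x - f v x - inner ℝ (stochGrad f v x) u) ν :=
  ((hi w).sub (hi v)).sub (hgi.inner_const (𝕜 := ℝ) u)

theorem integral_bregman (hi : ∀ v, Integrable (f v) ν)
    {v : Vec d} (hgi : Integrable (stochGrad f v) ν) (w u : Vec d) :
    ∫ x, (f w x - f v x - inner ℝ (stochGrad f v x) u) ∂ν
      = risk ν f w - risk ν f v - inner ℝ (∫ x, stochGrad f v x ∂ν) u := by
  have h1 := hgi.inner_const (𝕜 := ℝ) u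
  have h2 : Integrable (fun x => f w x - f v x) ν := (hi w).sub (hi v)
  rw [integral_sub h2 h1, integral_sub (hi w) (hi v)]
  simp_rw [real_inner_comm u]
  rw [integral_inner hgi]
  rfl

variable [IsProbabilityMeasure ν]

theorem memLp_stochGrad (hm : ∀ v, Measurable (f v)) (hs : ∀ x, IsLSmooth L (fun v => f v x))
    {w₀ : Vec d} (h0 : Integrable (fun x => ‖stochGrad f w₀ x‖ ^ 2) ν) (v : Vec d) :
    MemLp (stochGrad f v) 2 ν := by
  have h1 : MemLp (stochGrad f w₀) 2 ν :=
    (memLp_two_iff_integrable_sq_norm (measurable_stochGrad hm hs w₀).aestronglyMeasurable).2 h0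
  have h2 : MemLp (fun x => stochGrad f v x - stochGrad f w₀ x) 2 ν :=
    MemLp.of_bound ((measurable_stochGrad hm hs v).sub
      (measurable_stochGrad hm hs w₀)).aestronglyMeasurable _
      (Filter.Eventually.of_forall fun x => stochGrad_sub_le hs v w₀ x)
  have h3 : stochGrad f v = (fun x => stochGrad f v x - stochGrad f w₀ x) + stochGrad f w₀ := by
    ext1 x; simp
  rw [h3]
  exact h2.add h1

/-- Convexity and smoothness trap the first-order remainder of every `f(·;x)` between `0` and `L / 2
* ‖w - v‖ ^ 2`. This bound is uniform in `x`, so it survives integration and no dominated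
convergence is needed. -/
theorem hasGradientAt_risk (hi : ∀ v, Integrable (f v) ν)
    (hs : ∀ x, IsLSmooth L (fun v => f v x)) (hc : ∀ x, IsFirstOrderConvex 0 (fun v => f v x))
    (hg : ∀ v, MemLp (stochGrad f v) 2 ν) (v : Vec d) :
    HasGradientAt (risk ν f) (∫ x, stochGrad f v x ∂ν) v := by
  have hgi : Integrable (stochGrad f v) ν := (hg v).integrable (by norm_num)
  rw [hasGradientAt_iff_isLittleO]
  refine Asymptotics.IsBigO.trans_isLittleO (g := fun w => ‖w - v‖ ^ 2) ?_ ?_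
  · refine Asymptotics.IsBigO.of_bound (L / 2) (Filter.Eventually.of_forall fun w => ?_)
    rw [← integral_bregman hi hgi w]
    refine (norm_integral_le_of_norm_le_const (C := L / 2 * ‖w - v‖ ^ 2)
      (Filter.Eventually.of_forall fun x => ?_)).trans ?_
    · have h1 := (hs x).le_add_sq v (w - v)
      have h2 := hc x w v
      simp only [add_sub_cancel] at h1
      rw [Real.norm_eq_abs, abs_le, stochGrad]
      constructor <;> nlinarith [sq_nonneg ‖w - v‖]
    · simp
  · have h1 : (fun w : Vec d => ‖w - v‖ ^ 2) = fun w => ‖w - v‖ * ‖w - v‖ := by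
      ext; ring
    rw [h1, ← Asymptotics.isLittleO_norm_right]
    have h2 : (fun w : Vec d => ‖w - v‖) =o[nhds v] fun _ => (1 : ℝ) := by
      rw [Asymptotics.isLittleO_one_iff]
      have : Continuous fun w : Vec d => ‖w - v‖ := by fun_prop
      simpa using this.tendsto v
    simpa using h2.mul_isBigO (Asymptotics.isBigO_refl (fun w : Vec d => ‖w - v‖) (nhds v))

theorem isLSmooth_risk (hi : ∀ v, Integrable (f v) ν)
    (hs : ∀ x, IsLSmooth L (fun v => f v x)) (hc : ∀ x, IsFirstOrderConvex 0 (fun v => f v x))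
    (hg : ∀ v, MemLp (stochGrad f v) 2 ν) : IsLSmooth L (risk ν f) := by
  refine ⟨fun v => (hasGradientAt_risk hi hs hc hg v).differentiableAt, fun v w => ?_⟩
  rw [(hasGradientAt_risk hi hs hc hg v).gradient,
    (hasGradientAt_risk hi hs hc hg w).gradient,
    ← integral_sub ((hg v).integrable (by norm_num)) ((hg w).integrable (by norm_num))]
  refine (norm_integral_le_of_norm_le_const
    (Filter.Eventually.of_forall fun x => stochGrad_sub_le hs v w x)).trans ?_
  simp

/-- A crude bound in terms of the distance; it feeds the growth and delay inequalities. The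
contraction needs the risk-gap version below. -/
theorem integral_norm_stochGrad_sq_le (hs : ∀ x, IsLSmooth L (fun v => f v x))
    (hg : ∀ v, MemLp (stochGrad f v) 2 ν) (v w : Vec d) :
    ∫ x, ‖stochGrad f v x‖ ^ 2 ∂ν
      ≤ 2 * L ^ 2 * ‖v - w‖ ^ 2 + 2 * ∫ x, ‖stochGrad f w x‖ ^ 2 ∂ν := by
  have hw := (hg w).integrable_norm_pow (p := 2) two_ne_zero
  calc ∫ x, ‖stochGrad f v x‖ ^ 2 ∂ν
      ≤ ∫ x, (2 * L ^ 2 * ‖v - w‖ ^ 2 + 2 * ‖stochGrad f w x‖ ^ 2) ∂ν := by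
        refine integral_mono ((hg v).integrable_norm_pow (p := 2) two_ne_zero)
          ((integrable_const _).add (hw.const_mul 2)) fun x => ?_
        have h1 := stochGrad_sub_le hs v w x
        have h2 : ‖stochGrad f v x‖ ≤ ‖stochGrad f v x - stochGrad f w x‖ + ‖stochGrad f w x‖ := by
          simpa using norm_add_le (stochGrad f v x - stochGrad f w x) (stochGrad f w x)
        have h3 : ‖stochGrad f v x‖ ^ 2 ≤ (L * ‖v - w‖ + ‖stochGrad f w x‖) ^ 2 :=
          pow_le_pow_left₀ (norm_nonneg _) (h2.trans (by gcongr)) 2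
        dsimp only
        nlinarith [sq_nonneg (L * ‖v - w‖ - ‖stochGrad f w x‖)]
    _ = _ := by
        rw [integral_add (integrable_const _) (hw.const_mul 2), integral_const, integral_const_mul]
        simp

/-- Co-coercivity bounds the gradient difference by a Bregman remainder, whose linear term averages
to zero because the mean gradient at `w` vanishes. -/
theorem integral_norm_stochGrad_sq_le_risk (hL : 0 < L) (hi : ∀ v, Integrable (f v) ν)
    (hs : ∀ x, IsLSmooth L (fun v => f v x)) (hc : ∀ x, IsFirstOrderConvex 0 (fun v => f v x))
    (hg : ∀ v, MemLp (stochGrad f v) 2 ν) {w : Vec d}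
    (hw : ∫ x, stochGrad f w x ∂ν = 0) (v : Vec d) :
    ∫ x, ‖stochGrad f v x‖ ^ 2 ∂ν
      ≤ 4 * L * (risk ν f v - risk ν f w) + 2 * ∫ x, ‖stochGrad f w x‖ ^ 2 ∂ν := by
  have hwi := (hg w).integrable_norm_pow (p := 2) two_ne_zero
  have hgi : Integrable (stochGrad f w) ν := (hg w).integrable (by norm_num)
  have h1 := integrable_bregman hi hgi v (v - w)
  calc ∫ x, ‖stochGrad f v x‖ ^ 2 ∂ν
      ≤ ∫ x, (4 * L * (f v x - f w x - inner ℝ (stochGrad f w x) (v - w))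
          + 2 * ‖stochGrad f w x‖ ^ 2) ∂ν := by
        refine integral_mono ((hg v).integrable_norm_pow (p := 2) two_ne_zero)
          ((h1.const_mul _).add (hwi.const_mul 2)) fun x => ?_
        have h2 : ‖stochGrad f v x‖ ≤ ‖stochGrad f v x - stochGrad f w x‖ + ‖stochGrad f w x‖ := by
          simpa using norm_add_le (stochGrad f v x - stochGrad f w x) (stochGrad f w x)
        have h3 := (hc x).norm_gradient_sub_sq_le hL (hs x) v w
        change ‖stochGrad f v x - stochGrad f w x‖ ^ 2 ≤
          2 * L * (f v x - f w x - inner ℝ (stochGrad f w x) (v - w)) at h3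
        have h4 : ‖stochGrad f v x‖ ^ 2 ≤
            (‖stochGrad f v x - stochGrad f w x‖ + ‖stochGrad f w x‖) ^ 2 :=
          pow_le_pow_left₀ (norm_nonneg _) h2 2
        dsimp only
        nlinarith [sq_nonneg (‖stochGrad f v x - stochGrad f w x‖ - ‖stochGrad f w x‖)]
    _ = _ := by
        rw [integral_add (h1.const_mul _) (hwi.const_mul 2), integral_const_mul,
          integral_const_mul, integral_bregman hi hgi, hw, inner_zero_left, sub_zero]

/-- The one-step estimate behind the convergence rate, before taking expectations over the
iterate `w` and the read vector `v`. -/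
theorem descent_inequality {μ : ℝ} (hL : 0 < L) (hμ : 0 < μ) (hi : ∀ v, Integrable (f v) ν)
    (hF : IsFirstOrderConvex μ (risk ν f))
    (hs : ∀ x, IsLSmooth L (fun v => f v x)) (hc : ∀ x, IsFirstOrderConvex 0 (fun v => f v x))
    (hg : ∀ v, MemLp (stochGrad f v) 2 ν) {wstar : Vec d}
    (hmin : ∀ v, risk ν f wstar ≤ risk ν f v) {η D : ℝ} (hη : 0 ≤ η) (hD : 0 ≤ D)
    (hη' : 4 * L * D * η ≤ 1) (v w : Vec d) :
    -2 * inner ℝ (∫ x, stochGrad f v x ∂ν) (w - wstar)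
        + η * D * ∫ x, ‖stochGrad f v x‖ ^ 2 ∂ν
      ≤ -(μ / 2) * ‖w - wstar‖ ^ 2 + (2 * L + μ) * ‖w - v‖ ^ 2
        + η * D * (2 * ∫ x, ‖stochGrad f wstar x‖ ^ 2 ∂ν) := by
  have hgr := hasGradientAt_risk hi hs hc hg
  have h0 : ∫ x, stochGrad f wstar x ∂ν = 0 := by
    have hloc : IsLocalMin (risk ν f) wstar := Filter.Eventually.of_forall hmin
    have := hloc.hasFDerivAt_eq_zero (hgr wstar).hasFDerivAt
    simpa using this
  have h1 := integral_norm_stochGrad_sq_le_risk hL hi hs hc hg h0 v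
  have h2 := (hF.mono hμ.le).norm_gradient_sub_sq_le hL (isLSmooth_risk hi hs hc hg) v wstar
  rw [(hgr v).gradient, (hgr wstar).gradient, h0, sub_zero, inner_zero_left, sub_zero] at h2
  have h3 := hF wstar v
  rw [(hgr v).gradient] at h3
  set G := ∫ x, stochGrad f v x ∂ν
  set Δ := risk ν f v - risk ν f wstar with hΔ
  have hΔ0 : 0 ≤ Δ := sub_nonneg.2 (hmin v)
  have h4 : inner ℝ G (w - wstar) = inner ℝ G (w - v) - inner ℝ G (wstar - v) := by
    rw [← inner_sub_right]; congr 1; abel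
  have h5 : -inner ℝ G (w - v) ≤ ‖G‖ * ‖w - v‖ :=
    (neg_le_abs _).trans (abs_real_inner_le_norm G (w - v))
  -- Young's inequality weighted so that `‖G‖ ^ 2 ≤ 2 * L * Δ` costs exactly one of the two copies
  -- of `Δ`; `h7` below spends the other.
  have h6 : 2 * (‖G‖ * ‖w - v‖) ≤ Δ + 2 * L * ‖w - v‖ ^ 2 := by
    have h7 : 2 * (‖G‖ * ‖w - v‖) ≤ ‖G‖ ^ 2 / (2 * L) + 2 * L * ‖w - v‖ ^ 2 := by
      have : ‖G‖ ^ 2 / (2 * L) + 2 * L * ‖w - v‖ ^ 2 - 2 * (‖G‖ * ‖w - v‖)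
          = (‖G‖ - 2 * L * ‖w - v‖) ^ 2 / (2 * L) := by
        field_simp; ring
      have h8 : 0 ≤ (‖G‖ - 2 * L * ‖w - v‖) ^ 2 / (2 * L) := by positivity
      linarith
    have h8 : ‖G‖ ^ 2 / (2 * L) ≤ Δ := by
      rw [div_le_iff₀ (by positivity)]; linarith
    linarith
  have h7 : η * D * ∫ x, ‖stochGrad f v x‖ ^ 2 ∂ν
      ≤ Δ + η * D * (2 * ∫ x, ‖stochGrad f wstar x‖ ^ 2 ∂ν) := by
    have := mul_le_mul_of_nonneg_left h1 (mul_nonneg hη hD)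
    nlinarith [mul_le_mul_of_nonneg_right hη' hΔ0]
  have h8 : ‖w - wstar‖ ^ 2 ≤ 2 * ‖w - v‖ ^ 2 + 2 * ‖wstar - v‖ ^ 2 := by
    have h9 : ‖w - wstar‖ ≤ ‖w - v‖ + ‖wstar - v‖ := by
      rw [norm_sub_rev wstar v]; exact norm_sub_le_norm_sub_add_norm_sub w v wstar
    have h10 := pow_le_pow_left₀ (norm_nonneg _) h9 2
    nlinarith [sq_nonneg (‖w - v‖ - ‖wstar - v‖)]
  have h9 := mul_le_mul_of_nonneg_left h8 hμ.le
  rw [h4]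
  nlinarith

end Risk

/-! ### Deterministic analysis of the delayed recursion. -/

/-- Recursive inequalities with bounded delay between an error sequence `Y`, the error `Z` of
the delayed copy and the discrepancy `X` between the two. -/
structure IsDelayedRecursion (E R A c₁ c₂ c₃ c₄ c₅ : ℝ) (τ : ℕ) (Y Z X : ℕ → ℝ) : Prop where
  nonneg : ∀ t, 0 ≤ Y t
  init : Y 0 ≤ R
  growth : ∀ t, Y (t + 1) ≤ 2 * Y t + c₄ * Z t + c₅
  read : ∀ t, Z t ≤ 2 * Y t + 2 * X t
  delay : ∀ t, X t ≤ ∑ j ∈ Finset.Ico (t - τ) t, (c₂ * Z j + c₃) / (j + E) ^ 2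
  step : ∀ t : ℕ, Y (t + 1) ≤ (1 - 2 / (t + E)) * Y t + c₁ / (t + E) * X t + A / (t + E) ^ 2

namespace IsDelayedRecursion

variable {E R A c₁ c₂ c₃ c₄ c₅ : ℝ} {τ : ℕ}

theorem discrepancy_le {Y Z X : ℕ → ℝ} (h : IsDelayedRecursion E R A c₁ c₂ c₃ c₄ c₅ τ Y Z X)
    (hE : 0 < E) (hτ : 2 * (τ : ℝ) ≤ E) (hc₂ : 0 ≤ c₂) (hc₃ : 0 ≤ c₃) {K : ℝ} (hK : 0 ≤ K)
    {t : ℕ} (hZ : ∀ j < t, Z j ≤ K) : X t ≤ 4 * τ * (c₂ * K + c₃) / (t + E) ^ 2 := by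
  have ht : 0 < (t : ℝ) + E := by positivity
  refine (h.delay t).trans ?_
  calc ∑ j ∈ Finset.Ico (t - τ) t, (c₂ * Z j + c₃) / (j + E) ^ 2
      ≤ ∑ j ∈ Finset.Ico (t - τ) t, 4 * (c₂ * K + c₃) / (t + E) ^ 2 := by
        refine Finset.sum_le_sum fun j hj => ?_
        rw [Finset.mem_Ico] at hj
        have h1 : (t : ℝ) ≤ j + τ := by exact_mod_cast (by omega : t ≤ j + τ)
        -- Since `E ≥ 2τ`, going back `τ` steps at most halves `t + E`; squaring gives the factor
        -- `4`.
        have h2 : ((t : ℝ) + E) / 2 ≤ j + E := by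
          have : (0 : ℝ) ≤ t := t.cast_nonneg
          linarith
        have h3 : (((t : ℝ) + E) / 2) ^ 2 ≤ (j + E) ^ 2 :=
          pow_le_pow_left₀ (by positivity) h2 2
        have h4 : c₂ * Z j + c₃ ≤ c₂ * K + c₃ := by
          have := mul_le_mul_of_nonneg_left (hZ j hj.2) hc₂
          linarith
        calc (c₂ * Z j + c₃) / (j + E) ^ 2 ≤ (c₂ * K + c₃) / (j + E) ^ 2 := by gcongr
          _ ≤ (c₂ * K + c₃) / (((t : ℝ) + E) / 2) ^ 2 := by gcongr
          _ = 4 * (c₂ * K + c₃) / (t + E) ^ 2 := by field_simp; ring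
    _ ≤ τ * (4 * (c₂ * K + c₃) / (t + E) ^ 2) := by
        rw [Finset.sum_const, nsmul_eq_mul]
        have : ((Finset.Ico (t - τ) t).card : ℝ) ≤ τ := by
          rw [Nat.card_Ico]; exact_mod_cast (by omega)
        gcongr
    _ = _ := by ring

/-- Covers the times at which the contraction does not yet dominate, by iterating the growth bound
finitely often. The constant is chosen before the sequences, hence is uniform in them. -/
theorem exists_bound_initial (hE : 0 < E) (hτ : 2 * (τ : ℝ) ≤ E) (hc₂ : 0 ≤ c₂) (hc₃ : 0 ≤ c₃)
    (hc₄ : 0 ≤ c₄) (hc₅ : 0 ≤ c₅) (T : ℕ) :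
    ∃ K : ℝ, 1 ≤ K ∧ ∀ Y Z X, IsDelayedRecursion E R A c₁ c₂ c₃ c₄ c₅ τ Y Z X →
      ∀ t ≤ T, Y t ≤ K ∧ Z t ≤ K := by
  have key : ∀ {Y Z X : ℕ → ℝ}, IsDelayedRecursion E R A c₁ c₂ c₃ c₄ c₅ τ Y Z X → ∀ {K : ℝ},
      0 ≤ K → ∀ {t : ℕ}, (∀ j < t, Z j ≤ K) →
      Z t ≤ 2 * Y t + 2 * (4 * τ * (c₂ * K + c₃) / E ^ 2) := by
    intro Y Z X h K hK t hZ
    have h1 := h.discrepancy_le hE hτ hc₂ hc₃ hK hZ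
    have h2 : 4 * τ * (c₂ * K + c₃) / (t + E) ^ 2 ≤ 4 * τ * (c₂ * K + c₃) / E ^ 2 := by
      have : E ≤ t + E := by simp
      gcongr
    linarith [h.read t]
  induction T with
  | zero =>
    refine ⟨max 1 (max R (2 * R + 2 * (4 * τ * (c₂ * 0 + c₃) / E ^ 2))), le_max_left _ _,
      fun Y Z X h t ht => ?_⟩
    obtain rfl : t = 0 := by omega
    have h1 := key h le_rfl (t := 0) (by simp)
    have h2 := h.init
    exact ⟨h2.trans (le_max_of_le_right (le_max_left _ _)),
      (show Z 0 ≤ _ by linarith).trans (le_max_of_le_right (le_max_right _ _))⟩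
  | succ T ih =>
    obtain ⟨K, hK1, hK⟩ := ih
    have hK0 : 0 ≤ K := by linarith
    set y := 2 * K + c₄ * K + c₅ with hy
    set z := 2 * (4 * τ * (c₂ * K + c₃) / E ^ 2) with hz
    have hz0 : 0 ≤ z := by positivity
    have hy0 : K ≤ y := by nlinarith
    refine ⟨2 * y + z, by linarith, fun Y Z X h t ht => ?_⟩
    rcases Nat.lt_or_eq_of_le ht with ht | rfl
    · obtain ⟨h1, h2⟩ := hK Y Z X h t (by omega)
      constructor <;> linarith
    · obtain ⟨h1, h2⟩ := hK Y Z X h T le_rfl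
      have h3 := h.growth T
      have h4 := mul_le_mul_of_nonneg_left h2 hc₄
      have h5 := key h hK0 (t := T + 1) fun j hj => (hK Y Z X h j (by omega)).2
      constructor <;> linarith

theorem exists_bound (hE : 0 < E) (hτ : 2 * (τ : ℝ) ≤ E) (hA : 0 ≤ A) (hc₁ : 0 ≤ c₁)
    (hc₂ : 0 ≤ c₂) (hc₃ : 0 ≤ c₃) (hc₄ : 0 ≤ c₄) (hc₅ : 0 ≤ c₅) :
    ∃ K : ℝ, 1 ≤ K ∧ ∀ Y Z X, IsDelayedRecursion E R A c₁ c₂ c₃ c₄ c₅ τ Y Z X →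
      ∀ t, Z t ≤ K := by
  -- The discrepancy constant under the inductive bound `Z ≤ 4 * K`; since `K ≥ 1`, the constant
  -- term `c₃` is also at most `c₃ * K`.
  set B := 4 * τ * (4 * c₂ + c₃) with hB
  have hB0 : 0 ≤ B := by positivity
  -- Once `p = t + E ≥ Q`, the contraction removes `2 * K / p`, while the discrepancy and noise
  -- terms add at most `K / p` each. So `Y ≤ K` persists, and `Z ≤ 2 * Y + 2 * X ≤ 4 * K`.
  set Q := 2 + B + c₁ * B + A with hQ
  have hcB : 0 ≤ c₁ * B := by positivity
  obtain ⟨K, hK1, hK⟩ := exists_bound_initial (R := R) (A := A) (c₁ := c₁) hE hτ hc₂ hc₃ hc₄ hc₅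
    ⌈Q⌉₊
  have hK0 : 0 < K := by linarith
  refine ⟨4 * K, by linarith, fun Y Z X h t => ?_⟩
  suffices H : ∀ t, ∀ j ≤ t, Y j ≤ K ∧ Z j ≤ 4 * K from (H t t le_rfl).2
  intro t
  induction t with
  | zero =>
    intro j hj
    obtain ⟨h1, h2⟩ := hK Y Z X h j (by omega)
    exact ⟨h1, by linarith⟩
  | succ t ih =>
    intro j hj
    rcases Nat.lt_or_eq_of_le hj with hj | rfl
    · exact ih j (by omega)
    by_cases hT : t + 1 ≤ ⌈Q⌉₊
    · obtain ⟨h1, h2⟩ := hK Y Z X h _ hT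
      exact ⟨h1, by linarith⟩
    have hXle : ∀ s : ℕ, (∀ j < s, Z j ≤ 4 * K) → X s ≤ B * K / (s + E) ^ 2 := by
      intro s hs
      refine (h.discrepancy_le hE hτ hc₂ hc₃ (by positivity) hs).trans ?_
      have : 4 * τ * (c₂ * (4 * K) + c₃) ≤ B * K := by
        have : 4 * τ * (c₃ * 1) ≤ 4 * τ * (c₃ * K) := by gcongr
        rw [hB]; linarith
      gcongr
    have hp : Q ≤ t + E := by
      have h1 : Q ≤ t := (Nat.le_ceil Q).trans (by exact_mod_cast (by omega : ⌈Q⌉₊ ≤ t))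
      linarith
    have hX := hXle t fun j hj => (ih j hj.le).2
    have hX' := hXle (t + 1) fun j hj => (ih j (by omega)).2
    have hstep := h.step t
    have hY := (ih t le_rfl).1
    push_cast at hX'
    rw [show (t : ℝ) + 1 + E = (t + E) + 1 by ring] at hX'
    set p := (t : ℝ) + E
    have hp2 : 2 ≤ p := by linarith
    have hp0 : 0 < p := by linarith
    have h1 : Y (t + 1) ≤ K := by
      have e1 : (1 - 2 / p) * Y t ≤ (1 - 2 / p) * K := by
        have : 0 ≤ 1 - 2 / p := by rw [sub_nonneg, div_le_one hp0]; exact hp2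
        gcongr
      have e2 : c₁ / p * X t ≤ c₁ / p * (B * K / p ^ 2) := by gcongr
      have e3 : c₁ / p * (B * K / p ^ 2) ≤ K / p := by
        have : c₁ * B ≤ p ^ 2 := by nlinarith
        calc c₁ / p * (B * K / p ^ 2) = (c₁ * B) / p ^ 2 * (K / p) := by field_simp
          _ ≤ 1 * (K / p) := by
              gcongr
              exact (div_le_one (by positivity)).2 this
          _ = _ := one_mul _
      have e4 : A / p ^ 2 ≤ K / p := by
        have : A ≤ K * p := by nlinarith
        rw [div_le_div_iff₀ (by positivity) hp0]
        nlinarith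
      have e5 : (1 - 2 / p) * K = K - K / p - K / p := by ring
      linarith
    refine ⟨h1, ?_⟩
    have h2 : B * K / (p + 1) ^ 2 ≤ K := by
      rw [div_le_iff₀ (by positivity)]
      nlinarith
    linarith [h.read (t + 1)]

theorem sq_mul_le {Y Z X : ℕ → ℝ} (h : IsDelayedRecursion E R A c₁ c₂ c₃ c₄ c₅ τ Y Z X)
    (hE : 0 < E) (hc₁ : 0 ≤ c₁) {B : ℝ} (hB : 0 ≤ B)
    (hX : ∀ t : ℕ, X t ≤ B / (t + E) ^ 2) (t : ℕ) :
    ((t : ℝ) + 1 + E - 1) ^ 2 * Y (t + 1)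
      ≤ (E + 1) ^ 2 * R + A * (t + 1) + c₁ * B / E + 2 * (c₁ * B) * Real.log (t + 1) := by
  have hstep : ∀ t : ℕ, ((t : ℝ) + 1 + E - 1) ^ 2 * Y (t + 1)
      ≤ (t + E - 1) ^ 2 * Y t + A + c₁ * B / (t + E) := by
    intro t
    have hp0 : 0 < (t : ℝ) + E := by positivity
    have h1 := h.step t
    have h2 := hX t
    have h3 := h.nonneg t
    rw [show (t : ℝ) + 1 + E - 1 = t + E by ring]
    set p := (t : ℝ) + E
    have h4 : c₁ / p * X t ≤ c₁ / p * (B / p ^ 2) := by gcongr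
    calc p ^ 2 * Y (t + 1)
        ≤ p ^ 2 * ((1 - 2 / p) * Y t + c₁ / p * (B / p ^ 2) + A / p ^ 2) := by
          gcongr; linarith
      -- `p ^ 2 * (1 - 2 / p) = (p - 1) ^ 2 - 1`: the weights match those of the previous step, so
      -- the inequality telescopes.
      _ = ((p - 1) ^ 2 - 1) * Y t + A + c₁ * B / p := by
          field_simp; ring
      _ ≤ _ := by linarith
  induction t with
  | zero =>
    have h1 := hstep 0
    have h2 : ((0 : ℕ) + E - 1) ^ 2 * Y 0 ≤ (E + 1) ^ 2 * R := by
      have h3 := h.nonneg 0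
      have h4 : (E - 1) ^ 2 ≤ (E + 1) ^ 2 := by nlinarith
      rw [Nat.cast_zero, zero_add]
      exact mul_le_mul h4 h.init h3 (by positivity)
    simp only [Nat.cast_zero, zero_add, Real.log_one, mul_zero, add_zero, mul_one] at h1 h2 ⊢
    linarith
  | succ t ih =>
    have h1 := hstep (t + 1)
    push_cast at h1 ⊢
    have h2 : c₁ * B / ((t : ℝ) + 1 + E)
        ≤ 2 * (c₁ * B) * (Real.log (t + 1 + 1) - Real.log (t + 1)) := by
      have hl : 1 / ((t : ℝ) + 1 + 1) ≤ Real.log (t + 1 + 1) - Real.log (t + 1) := by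
        rw [← Real.log_div (by positivity) (by positivity)]
        refine le_trans (le_of_eq ?_)
          (Real.one_sub_inv_le_log_of_pos (by positivity : 0 < ((t : ℝ) + 1 + 1) / (t + 1)))
        field_simp
        ring
      -- Only `E > 0` is available, so comparison with the logarithm increment costs a factor `2`.
      have hl' : 1 / ((t : ℝ) + 1 + E) ≤ 2 * (1 / ((t : ℝ) + 1 + 1)) := by
        rw [mul_one_div, div_le_div_iff₀ (by positivity) (by positivity)]
        have : (0 : ℝ) ≤ t := t.cast_nonneg
        nlinarith
      calc c₁ * B / ((t : ℝ) + 1 + E) = c₁ * B * (1 / ((t : ℝ) + 1 + E)) := by ring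
        _ ≤ c₁ * B * (2 * (Real.log (t + 1 + 1) - Real.log (t + 1))) := by
          gcongr; linarith
        _ = _ := by ring
    linarith

theorem exists_rate (hE : 0 < E) (hτ : 2 * (τ : ℝ) ≤ E) (hR : 0 ≤ R) (hA : 0 ≤ A)
    (hc₁ : 0 ≤ c₁) (hc₂ : 0 ≤ c₂) (hc₃ : 0 ≤ c₃) (hc₄ : 0 ≤ c₄) (hc₅ : 0 ≤ c₅) :
    ∃ C : ℝ, ∀ Y Z X, IsDelayedRecursion E R A c₁ c₂ c₃ c₄ c₅ τ Y Z X →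
      ∀ t : ℕ, 2 ≤ t →
        Y t ≤ 4 * A * (t / (t + E - 1) ^ 2) + C * (Real.log t / (t + E - 1) ^ 2) ∧
        Z t ≤ 4 * A * (t / (t + E - 1) ^ 2) + C * (Real.log t / (t + E - 1) ^ 2) := by
  obtain ⟨K, hK1, hK⟩ := exists_bound (R := R) hE hτ hA hc₁ hc₂ hc₃ hc₄ hc₅
  set B := 4 * τ * (c₂ * K + c₃) with hB
  have hB0 : 0 ≤ B := by positivity
  set c₆ := (E + 1) ^ 2 * R + c₁ * B / E with hc₆
  have hc₆0 : 0 ≤ c₆ := by positivity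
  -- Dividing by `Real.log 2` lets the constants be absorbed into `Real.log t` for `t ≥ 2`; the
  -- outer `2` comes from `Z ≤ 2 * Y + 2 * X`.
  set C := 2 * ((c₆ + B) / Real.log 2 + 2 * (c₁ * B)) with hC
  refine ⟨C, fun Y Z X h t ht => ?_⟩
  have hX : ∀ t : ℕ, X t ≤ B / (t + E) ^ 2 := fun t =>
    h.discrepancy_le hE hτ hc₂ hc₃ (by linarith) fun j _ => hK Y Z X h j
  have hY := h.sq_mul_le hE hc₁ hB0 hX (t - 1)
  rw [Nat.sub_add_cancel (by omega)] at hY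
  have ecast : ((t - 1 : ℕ) : ℝ) + 1 = t := by
    rw [Nat.cast_sub (by omega)]; simp
  rw [ecast] at hY
  have ht' : (2 : ℝ) ≤ t := by exact_mod_cast ht
  have hq : 0 < (t : ℝ) + E - 1 := by linarith
  have hXt := hX t
  have hX' : ((t : ℝ) + E - 1) ^ 2 * X t ≤ B := by
    rw [le_div_iff₀ (by positivity)] at hXt
    have h1 : ((t : ℝ) + E - 1) ^ 2 ≤ (t + E) ^ 2 := pow_le_pow_left₀ hq.le (by linarith) 2
    rcases le_total 0 (X t) with h0 | h0
    · nlinarith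
    · nlinarith [sq_nonneg ((t : ℝ) + E - 1)]
  have hread := h.read t
  have hY0 := h.nonneg t
  have hlog2 : 0 < Real.log 2 := Real.log_pos (by norm_num)
  have hlog : Real.log 2 ≤ Real.log t := Real.log_le_log (by norm_num) ht'
  have hcl : c₆ + B ≤ (c₆ + B) / Real.log 2 * Real.log t := by
    calc c₆ + B = (c₆ + B) / Real.log 2 * Real.log 2 := by field_simp
      _ ≤ _ := by gcongr
  have hrhs : 4 * A * (t / (t + E - 1) ^ 2) + C * (Real.log t / (t + E - 1) ^ 2)
      = (4 * A * t + C * Real.log t) / (t + E - 1) ^ 2 := by ring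
  have hAt : 0 ≤ A * t := by positivity
  have hsum : ((t : ℝ) + E - 1) ^ 2 * Y t
      ≤ c₆ + A * t + 2 * (c₁ * B) * Real.log t := by linarith
  have hC' : C * Real.log t = 2 * ((c₆ + B) / Real.log 2 * Real.log t)
      + 2 * (2 * (c₁ * B) * Real.log t) := by rw [hC]; ring
  have h5 : 0 ≤ 2 * (c₁ * B) * Real.log t := by positivity
  have hZ' : 2 * Y t + 2 * X t ≤ (4 * A * t + C * Real.log t) / (t + E - 1) ^ 2 := by
    rw [le_div_iff₀ (by positivity), hC']
    have e1 : (2 * Y t + 2 * X t) * ((t : ℝ) + E - 1) ^ 2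
      = 2 * (((t : ℝ) + E - 1) ^ 2 * Y t) + 2 * (((t : ℝ) + E - 1) ^ 2 * X t) := by ring
    rw [e1]
    linarith
  have hY' : Y t ≤ (4 * A * t + C * Real.log t) / (t + E - 1) ^ 2 := by
    rw [le_div_iff₀ (by positivity), hC', mul_comm (Y t)]
    linarith
  rw [hrhs]
  exact ⟨hY', hread.trans hZ'⟩

end IsDelayedRecursion

/-! ### Coordinate filters and partitions. -/

section FilterVec

variable {d : ℕ}

@[simp]
theorem filterVec_apply (s : Finset (Fin d)) (v : Vec d) (i : Fin d) :
    filterVec s v i = if i ∈ s then v i else 0 := rfl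

@[simp]
theorem filterVec_empty (v : Vec d) : filterVec ∅ v = 0 := by
  ext i; simp

theorem norm_filterVec_sq (s : Finset (Fin d)) (v : Vec d) :
    ‖filterVec s v‖ ^ 2 = ∑ i ∈ s, v i ^ 2 := by
  simp [EuclideanSpace.norm_sq_eq, ite_pow]

theorem filterVec_eq_sum_single (s : Finset (Fin d)) (v : Vec d) :
    filterVec s v = ∑ i ∈ s, EuclideanSpace.single i (v i) := by
  ext j
  simp

theorem norm_filterVec_le (s : Finset (Fin d)) (v : Vec d) : ‖filterVec s v‖ ≤ ‖v‖ := by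
  refine le_of_pow_le_pow_left₀ two_ne_zero (norm_nonneg _) ?_
  rw [norm_filterVec_sq, EuclideanSpace.norm_sq_eq]
  simp only [Real.norm_eq_abs, sq_abs]
  exact Finset.sum_le_univ_sum_of_nonneg fun i => sq_nonneg _

theorem norm_sub_filterVec_le (s : Finset (Fin d)) (v : Vec d) :
    ‖v - filterVec s v‖ ≤ ‖v‖ := by
  have : v - filterVec s v = filterVec sᶜ v := by
    ext i
    by_cases h : i ∈ s <;> simp [h]
  rw [this]
  exact norm_filterVec_le _ _

theorem sum_parts_sum {β : Type*} [AddCommMonoid β] {t : Finset (Fin d)} (p : Finpartition t)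
    (g : Fin d → β) : ∑ s ∈ p.parts, ∑ i ∈ s, g i = ∑ i ∈ t, g i := by
  conv_rhs => rw [← p.biUnion_parts]
  exact (Finset.sum_biUnion p.supIndep.pairwiseDisjoint).symm

theorem sum_parts_norm_filterVec_sq_le {t : Finset (Fin d)} (p : Finpartition t) (v : Vec d) :
    ∑ s ∈ p.parts, ‖filterVec s v‖ ^ 2 ≤ ‖v‖ ^ 2 := by
  simp_rw [norm_filterVec_sq]
  rw [sum_parts_sum, ← norm_filterVec_sq]
  exact pow_le_pow_left₀ (norm_nonneg _) (norm_filterVec_le _ _) 2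

theorem sum_parts_filterVec {t : Finset (Fin d)} (p : Finpartition t) (v : Vec d) :
    ∑ s ∈ p.parts, filterVec s v = filterVec t v := by
  simp_rw [filterVec_eq_sum_single]
  exact sum_parts_sum p _

theorem filterVec_gradSupport {Ξ : Type u} (f : Vec d → Ξ → ℝ) (v : Vec d) (x : Ξ) :
    filterVec (gradSupport f x) (stochGrad f v x) = stochGrad f v x := by
  ext i
  by_cases h : i ∈ gradSupport f x
  · simp [h]
  · have : stochGrad f v x i = 0 := by
      by_contra h'
      exact h (by simp only [gradSupport, Finset.mem_filter, Finset.mem_univ, true_and]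
                  exact ⟨v, h'⟩)
    simp [h, this]

theorem measurable_filterVec {Ω : Type v} {m : MeasurableSpace Ω} {S : Ω → Finset (Fin d)}
    (hS : ∀ i, MeasurableSet {ω | i ∈ S ω}) {V : Ω → Vec d} (hV : Measurable V) :
    Measurable fun ω => filterVec (S ω) (V ω) := by
  refine (WithLp.measurable_toLp 2 _).comp (measurable_pi_iff.2 fun i => ?_)
  exact Measurable.ite (hS i)
    ((measurable_pi_apply i).comp ((WithLp.measurable_ofLp 2 _).comp hV)) measurable_const

theorem measurableSet_eq_finset {Ω : Type v} [MeasurableSpace Ω] {S : Ω → Finset (Fin d)}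
    (hS : ∀ i, MeasurableSet {ω | i ∈ S ω}) (s : Finset (Fin d)) :
    MeasurableSet {ω | S ω = s} := by
  have : {ω | S ω = s} = ⋂ i, {ω | i ∈ S ω ↔ i ∈ s} := by
    ext ω
    simp [Finset.ext_iff]
  rw [this]
  exact MeasurableSet.iInter fun i => (hS i).iff (MeasurableSet.const _)

end FilterVec

namespace IsFilterPartition

variable {d : ℕ} {Ξ : Type u} [MeasurableSpace Ξ] {f : Vec d → Ξ → ℝ} {D : ℕ}
  {part : (ξ : Ξ) → Finpartition (gradSupport f ξ)}

/-- A sum over a random family of sets is a fixed finite sum over all subsets, weighted by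
measurable indicators. -/
theorem measurable_sum_parts (h : IsFilterPartition f D part) {Ω : Type v} [MeasurableSpace Ω]
    {X : Ω → Ξ} (hX : Measurable X) {Φ : Finset (Fin d) → Ω → ℝ} (hΦ : ∀ s, Measurable (Φ s)) :
    Measurable fun ω => ∑ s ∈ (part (X ω)).parts, Φ s ω := by
  have : (fun ω => ∑ s ∈ (part (X ω)).parts, Φ s ω)
      = fun ω => ∑ s, if s ∈ (part (X ω)).parts then Φ s ω else 0 := by
    ext ω; simp
  rw [this]
  exact Finset.measurable_sum _ fun s _ =>
    Measurable.ite (hX (h.measurable s)) (hΦ s) measurable_const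

theorem measurable_card_parts (h : IsFilterPartition f D part) :
    Measurable fun x => ((part x).parts.card : ℝ) := by
  simpa using h.measurable_sum_parts measurable_id (Φ := fun _ _ => 1) fun _ => measurable_const

/-- Measurability is assumed of the partition only; `|D_ξ|` is recovered as the sum of its part
sizes. -/
theorem measurable_card_gradSupport (h : IsFilterPartition f D part) :
    Measurable fun x => (gradSupport f x).card := by
  have h1 : Measurable fun x => ((gradSupport f x).card : ℝ) := by
    have := h.measurable_sum_parts measurable_id (Φ := fun s _ => (s.card : ℝ))
      fun _ => measurable_const
    convert this using 2 with x
    exact_mod_cast (part x).sum_card_parts.symm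
  have h2 : (fun x => (gradSupport f x).card) = fun x => ⌊((gradSupport f x).card : ℝ)⌋₊ := by
    ext x; simp
  rw [h2]
  exact Nat.measurable_floor.comp h1

theorem card_parts_le (h : IsFilterPartition f D part) (x : Ξ) :
    ((part x).parts.card : ℝ) ≤ D := by
  rw [h.card_parts x]
  exact_mod_cast min_le_left _ _

end IsFilterPartition

theorem IsFilterPartition.measurable_hogwildUpdate {d : ℕ} {Ξ : Type u} [MeasurableSpace Ξ]
    {f : Vec d → Ξ → ℝ} {D : ℕ} {part : (ξ : Ξ) → Finpartition (gradSupport f ξ)} {L : ℝ}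
    (hp : IsFilterPartition f D part) (hm : ∀ v, Measurable (f v))
    (hs : ∀ x, IsLSmooth L (fun v => f v x)) {Ω : Type v} {m : MeasurableSpace Ω} {X : Ω → Ξ}
    (hX : Measurable X) {S : Ω → Finset (Fin d)} (hS : ∀ i, MeasurableSet {ω | i ∈ S ω})
    {V : Ω → Vec d} (hV : Measurable V) (η : ℝ) :
    Measurable fun ω => hogwildUpdate f part η (X ω) (S ω) (V ω) :=
  ((hp.measurable_card_parts.comp hX).const_mul η).smul
    (measurable_filterVec hS ((measurable_uncurry_stochGrad hm hs).comp (hV.prodMk hX)))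

theorem integrable_inner_of_memLp {d : ℕ} {Ω : Type v} [MeasurableSpace Ω] {P : Measure Ω}
    {V W : Ω → Vec d} (hV : MemLp V 2 P) (hW : MemLp W 2 P) :
    Integrable (fun ω => inner ℝ (V ω) (W ω)) P :=
  (hV.norm.integrable_mul hW.norm).mono (hV.1.inner hW.1)
    (Filter.Eventually.of_forall fun ω => by
      simpa using abs_real_inner_le_norm (V ω) (W ω))

/-! ### Adaptedness, and averaging over the random choices. -/

namespace IsHogwildRun

variable {d : ℕ} {Ξ : Type u} [MeasurableSpace Ξ] {ν : Measure Ξ}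
  {f : Vec d → Ξ → ℝ} {part : (ξ : Ξ) → Finpartition (gradSupport f ξ)} {τ : ℕ} {η : ℕ → ℝ}
  {Ω : Type v} [mΩ : MeasurableSpace Ω] {P : Measure Ω}
  {ℱ : Filtration ℕ mΩ} {ξ : ℕ → Ω → Ξ} {S : ℕ → Ω → Finset (Fin d)}
  {M : ℕ → ℕ → Ω → Finset (Fin d)} {w what : ℕ → Ω → Vec d} {L : ℝ} {D : ℕ}

theorem measurable_sample' (h : IsHogwildRun ν f part τ η P ℱ ξ S M w what) (t : ℕ) :
    Measurable (ξ t) :=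
  (h.measurable_sample t).mono (ℱ.le _) le_rfl

theorem sup_comap_le (h : IsHogwildRun ν f part τ η P ℱ ξ S M w what) (t : ℕ) :
    ℱ t ⊔ MeasurableSpace.comap (ξ t) inferInstance ≤ mΩ :=
  sup_le (ℱ.le t) (h.measurable_sample' t).comap_le

theorem measurable_update (h : IsHogwildRun ν f part τ η P ℱ ξ S M w what)
    (hm : ∀ v, Measurable (f v)) (hs : ∀ x, IsLSmooth L (fun v => f v x))
    (hp : IsFilterPartition f D part) {t : ℕ} (hw : Measurable[ℱ t] (what t)) :
    Measurable[ℱ (t + 1)] fun ω =>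
      hogwildUpdate f part (η t) (ξ t ω) (S t ω) (what t ω) := by
  exact hp.measurable_hogwildUpdate (m := ℱ (t + 1)) hm hs (h.measurable_sample t) (h.measurable_filter t)
    (hw.mono (ℱ.mono (Nat.le_succ t)) le_rfl) (η t)

theorem measurable_iterate_read (h : IsHogwildRun ν f part τ η P ℱ ξ S M w what)
    (hm : ∀ v, Measurable (f v)) (hs : ∀ x, IsLSmooth L (fun v => f v x))
    (hp : IsFilterPartition f D part) (t : ℕ) :
    Measurable[ℱ t] (w t) ∧ Measurable[ℱ t] (what t) := by
  induction t using Nat.strong_induction_on with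
  | _ t ih =>
    have hw : Measurable[ℱ t] (w t) := by
      cases t with
      | zero => exact h.measurable_init
      | succ t =>
        have e : w (t + 1) = fun ω =>
            w t ω - hogwildUpdate f part (η t) (ξ t ω) (S t ω) (what t ω) :=
          funext (h.step t)
        rw [e]
        obtain ⟨h1, h2⟩ := ih t (Nat.lt_succ_self t)
        exact (h1.mono (ℱ.mono (Nat.le_succ t)) le_rfl).sub (h.measurable_update hm hs hp h2)
    refine ⟨hw, ?_⟩
    have e : what t = fun ω => w (t - τ) ω - ∑ j ∈ Finset.Ico (t - τ) t,
        filterVec (M t j ω) (hogwildUpdate f part (η j) (ξ j ω) (S j ω) (what j ω)) :=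
      funext (h.read t)
    rw [e]
    have h1 : Measurable[ℱ t] (w (t - τ)) := by
      -- Equality occurs when `τ = 0` or `t = 0`; the read then starts from `w t` itself, which is
      -- why `hw` is proved beforehand.
      rcases Nat.lt_or_eq_of_le (Nat.sub_le t τ) with hlt | heq
      · exact (ih _ hlt).1.mono (ℱ.mono hlt.le) le_rfl
      · rw [heq]; exact hw
    have h2 : ∀ j ∈ Finset.Ico (t - τ) t, Measurable[ℱ t] fun ω =>
        filterVec (M t j ω) (hogwildUpdate f part (η j) (ξ j ω) (S j ω) (what j ω)) := by
      intro j hj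
      have hjt := (Finset.mem_Ico.1 hj).2
      exact measurable_filterVec (m := ℱ t) (h.measurable_mask t j)
        ((h.measurable_update hm hs hp (ih j hjt).2).mono (ℱ.mono hjt) le_rfl)
    exact h1.sub (Finset.measurable_sum _ h2)

variable [IsProbabilityMeasure P]

/-- Averaging over the uniformly selected set. -/
theorem integral_selected (h : IsHogwildRun ν f part τ η P ℱ ξ S M w what) (t : ℕ)
    {Φ : Finset (Fin d) → Ω → ℝ}
    (hΦm : ∀ s, Measurable[ℱ t ⊔ MeasurableSpace.comap (ξ t) inferInstance] (Φ s))
    (hΦi : ∀ s, Integrable (Φ s) P) (h0 : ∀ ω, Φ ∅ ω = 0) :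
    Integrable (fun ω => ∑ s ∈ (part (ξ t ω)).parts,
        ((part (ξ t ω)).parts.card : ℝ)⁻¹ * Φ s ω) P ∧
      ∫ ω, Φ (S t ω) ω ∂P = ∫ ω, ∑ s ∈ (part (ξ t ω)).parts,
        ((part (ξ t ω)).parts.card : ℝ)⁻¹ * Φ s ω ∂P := by
  have hset : ∀ s, MeasurableSet {ω | S t ω = s} := measurableSet_eq_finset fun i =>
    ℱ.le _ _ (h.measurable_filter t i)
  let I : Finset (Fin d) → Ω → ℝ := fun s => Set.indicator {ω | S t ω = s} fun _ => (1 : ℝ)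
  let J : Finset (Fin d) → Ω → ℝ := fun s ω =>
    if s ∈ (part (ξ t ω)).parts then (((part (ξ t ω)).parts.card : ℝ))⁻¹ else 0
  have hIi : ∀ s, Integrable (I s) P := fun s => (integrable_const 1).indicator (hset s)
  have hIΦ : ∀ s, Integrable (I s * Φ s) P := by
    intro s
    have : I s * Φ s = Set.indicator {ω | S t ω = s} (Φ s) := by
      ext ω
      by_cases hω : S t ω = s <;> simp [I, Set.indicator, hω]
    rw [this]
    exact (hΦi s).indicator (hset s)
  -- For a fixed set `s`, `Φ s` is known given the past and the sample, so it leaves the conditional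
  -- expectation and only the selection probability remains. The uniform law covers nonempty sets
  -- only; `h0` discards the empty one.
  have hce : ∀ s, s.Nonempty →
      P[I s * Φ s | ℱ t ⊔ MeasurableSpace.comap (ξ t) inferInstance] =ᵐ[P] J s * Φ s := by
    intro s hs
    filter_upwards [condExp_mul_of_stronglyMeasurable_right (hΦm s).stronglyMeasurable
      (hIΦ s) (hIi s), h.uniform_filter t s hs] with ω h1 h2
    rw [h1, Pi.mul_apply, Pi.mul_apply, h2]
  have hJi : ∀ s, s.Nonempty → Integrable (J s * Φ s) P := fun s hs =>
    integrable_condExp.congr (hce s hs)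
  have hJint : ∀ s, s.Nonempty → ∫ ω, (I s * Φ s) ω ∂P = ∫ ω, (J s * Φ s) ω ∂P := fun s hs => by
    rw [← integral_condExp (h.sup_comap_le t)]
    exact integral_congr_ae (hce s hs)
  have hne : ∀ s ∈ (Finset.univ.erase (∅ : Finset (Fin d))), s.Nonempty := fun s hs =>
    Finset.nonempty_iff_ne_empty.2 (Finset.ne_of_mem_erase hs)
  have e1 : ∀ ω, Φ (S t ω) ω = ∑ s ∈ Finset.univ.erase ∅, (I s * Φ s) ω := by
    intro ω
    rw [Finset.sum_erase _ (by simp [h0]), Finset.sum_eq_single (S t ω)]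
    · simp [I]
    · intro s _ hs
      have : S t ω ≠ s := hs.symm
      simp [I, this]
    · simp
  have e2 : ∀ ω, ∑ s ∈ (part (ξ t ω)).parts, ((part (ξ t ω)).parts.card : ℝ)⁻¹ * Φ s ω
      = ∑ s ∈ Finset.univ.erase ∅, (J s * Φ s) ω := by
    intro ω
    rw [Finset.sum_erase _ (by simp [h0])]
    simp [J, ite_mul]
  simp_rw [e1, e2]
  refine ⟨integrable_finsetSum _ fun s hs => hJi s (hne s hs), ?_⟩
  rw [integral_finsetSum _ fun s _ => hIΦ s,
    integral_finsetSum _ fun s hs => hJi s (hne s hs)]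
  exact Finset.sum_congr rfl fun s hs => hJint s (hne s hs)

/-- Averaging over the fresh sample. -/
theorem integral_sample (h : IsHogwildRun ν f part τ η P ℱ ξ S M w what) (t : ℕ)
    {β : Type*} [MeasurableSpace β] {V : Ω → β} (hV : Measurable[ℱ t] V)
    {Ψ : β × Ξ → ℝ} (hΨ : Measurable Ψ) (hi : Integrable (fun ω => Ψ (V ω, ξ t ω)) P) :
    Integrable (fun ω => ∫ x, Ψ (V ω, x) ∂ν) P ∧
      ∫ ω, Ψ (V ω, ξ t ω) ∂P = ∫ ω, ∫ x, Ψ (V ω, x) ∂ν ∂P := by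
  have hV' : Measurable V := hV.mono (ℱ.le t) le_rfl
  have hξ := h.measurable_sample' t
  have hind : IndepFun V (ξ t) P := by
    refine Indep.symm (indep_of_indep_of_le_right (h.indep_sample t) hV.comap_le)
  -- Independence makes the joint law a product, and Fubini integrates out the sample with `V`
  -- frozen.
  have hmap := hind.map_prod_eq_prod_map_map hV'.aemeasurable hξ.aemeasurable
  rw [h.law_sample t] at hmap
  have : IsProbabilityMeasure ν := by
    rw [← h.law_sample t]; exact Measure.isProbabilityMeasure_map hξ.aemeasurable
  have : IsProbabilityMeasure (P.map V) := Measure.isProbabilityMeasure_map hV'.aemeasurable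
  have hpair : Measurable fun ω => (V ω, ξ t ω) := hV'.prodMk hξ
  have hi' : Integrable Ψ ((P.map V).prod ν) := by
    rw [← hmap]
    exact (integrable_map_measure hΨ.aestronglyMeasurable hpair.aemeasurable).2 hi
  have hi2 := hi'.integral_prod_left
  refine ⟨(integrable_map_measure hi2.1 hV'.aemeasurable).1 hi2, ?_⟩
  rw [← integral_map (μ := P) hpair.aemeasurable (f := Ψ) hΨ.aestronglyMeasurable, hmap,
    integral_prod _ hi', integral_map hV'.aemeasurable hi2.1]

end IsHogwildRun

/-! ### Mean and second moment of one filtered update. -/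

section Update

variable {d : ℕ} {Ξ : Type u} [MeasurableSpace Ξ] {f : Vec d → Ξ → ℝ} {D : ℕ}
  {part : (ξ : Ξ) → Finpartition (gradSupport f ξ)}

theorem IsFilterPartition.norm_hogwildUpdate_le (hp : IsFilterPartition f D part) (η : ℝ) (x : Ξ)
    (s : Finset (Fin d)) (v : Vec d) :
    ‖hogwildUpdate f part η x s v‖ ≤ |η| * D * ‖stochGrad f v x‖ := by
  rw [hogwildUpdate, norm_smul, Real.norm_eq_abs, abs_mul, Nat.abs_cast]
  have h1 := hp.card_parts_le x
  have h2 := norm_filterVec_le s (stochGrad f v x)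
  gcongr

-- Unbiasedness: the number of parts cancels the selection probability, and the parts reassemble the
-- full gradient. If `D_ξ` is empty, both sides vanish.
omit [MeasurableSpace Ξ] in
theorem sum_parts_inner_hogwildUpdate (η : ℝ) (x : Ξ) (v u : Vec d) :
    ∑ s ∈ (part x).parts, ((part x).parts.card : ℝ)⁻¹ * inner ℝ (hogwildUpdate f part η x s v) u
      = η * inner ℝ (stochGrad f v x) u := by
  have h1 : ∀ s ∈ (part x).parts,
      ((part x).parts.card : ℝ)⁻¹ * inner ℝ (hogwildUpdate f part η x s v) u
        = η * inner ℝ (filterVec s (stochGrad f v x)) u := by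
    intro s hs
    have : ((part x).parts.card : ℝ) ≠ 0 := by
      exact_mod_cast (Finset.card_pos.2 ⟨s, hs⟩).ne'
    rw [hogwildUpdate, real_inner_smul_left]
    field_simp
  rw [Finset.sum_congr rfl h1, ← Finset.mul_sum, ← sum_inner, sum_parts_filterVec,
    filterVec_gradSupport]

/-- The squared scaling times the selection probability leaves one factor `d_ξ ≤ D`; by disjointness
the squared norms of the pieces add up to at most that of the gradient. -/
theorem IsFilterPartition.sum_parts_norm_hogwildUpdate_sq_le (hp : IsFilterPartition f D part)
    (η : ℝ) (x : Ξ) (v : Vec d) :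
    ∑ s ∈ (part x).parts, ((part x).parts.card : ℝ)⁻¹ * ‖hogwildUpdate f part η x s v‖ ^ 2
      ≤ η ^ 2 * D * ‖stochGrad f v x‖ ^ 2 := by
  have h1 : ∀ s ∈ (part x).parts,
      ((part x).parts.card : ℝ)⁻¹ * ‖hogwildUpdate f part η x s v‖ ^ 2
        = η ^ 2 * (part x).parts.card * ‖filterVec s (stochGrad f v x)‖ ^ 2 := by
    intro s hs
    have : ((part x).parts.card : ℝ) ≠ 0 := by
      exact_mod_cast (Finset.card_pos.2 ⟨s, hs⟩).ne'
    rw [hogwildUpdate, norm_smul, mul_pow, Real.norm_eq_abs, sq_abs, mul_pow]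
    generalize ‖filterVec s (stochGrad f v x)‖ ^ 2 = q
    generalize ((part x).parts.card : ℝ) = c at this
    field_simp
  rw [Finset.sum_congr rfl h1, ← Finset.mul_sum]
  have h2 := sum_parts_norm_filterVec_sq_le (part x) (stochGrad f v x)
  exact mul_le_mul (mul_le_mul_of_nonneg_left (hp.card_parts_le x) (sq_nonneg η)) h2
    (Finset.sum_nonneg fun _ _ => sq_nonneg _) (by positivity)

end Update

/-! ### Square integrability and moment bounds along a run. -/

namespace IsHogwildRun

variable {d : ℕ} {Ξ : Type u} [MeasurableSpace Ξ] {ν : Measure Ξ}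
  {f : Vec d → Ξ → ℝ} {part : (ξ : Ξ) → Finpartition (gradSupport f ξ)} {τ : ℕ} {η : ℕ → ℝ}
  {Ω : Type v} [mΩ : MeasurableSpace Ω] {P : Measure Ω}
  {ℱ : Filtration ℕ mΩ} {ξ : ℕ → Ω → Ξ} {S : ℕ → Ω → Finset (Fin d)}
  {M : ℕ → ℕ → Ω → Finset (Fin d)} {w what : ℕ → Ω → Vec d} {L : ℝ} {D : ℕ} {wstar : Vec d}

theorem measurable_read (h : IsHogwildRun ν f part τ η P ℱ ξ S M w what)
    (hm : ∀ v, Measurable (f v)) (hs : ∀ x, IsLSmooth L (fun v => f v x))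
    (hp : IsFilterPartition f D part) (t : ℕ) : Measurable (what t) :=
  (h.measurable_iterate_read hm hs hp t).2.mono (ℱ.le t) le_rfl

theorem measurable_stochGrad_sample (h : IsHogwildRun ν f part τ η P ℱ ξ S M w what)
    (hm : ∀ v, Measurable (f v)) (hs : ∀ x, IsLSmooth L (fun v => f v x))
    (hp : IsFilterPartition f D part) (t : ℕ) :
    Measurable fun ω => stochGrad f (what t ω) (ξ t ω) :=
  (measurable_uncurry_stochGrad hm hs).comp
    ((h.measurable_read hm hs hp t).prodMk (h.measurable_sample' t))

theorem measurable_update' (h : IsHogwildRun ν f part τ η P ℱ ξ S M w what)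
    (hm : ∀ v, Measurable (f v)) (hs : ∀ x, IsLSmooth L (fun v => f v x))
    (hp : IsFilterPartition f D part) (t : ℕ) :
    Measurable fun ω => hogwildUpdate f part (η t) (ξ t ω) (S t ω) (what t ω) :=
  (h.measurable_update hm hs hp (h.measurable_iterate_read hm hs hp t).2).mono (ℱ.le _) le_rfl

theorem memLp_stochGrad_sample (h : IsHogwildRun ν f part τ η P ℱ ξ S M w what)
    (hm : ∀ v, Measurable (f v)) (hs : ∀ x, IsLSmooth L (fun v => f v x))
    (hp : IsFilterPartition f D part) (hg : ∀ v, MemLp (stochGrad f v) 2 ν) {t : ℕ}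
    (hw : MemLp (fun ω => what t ω - wstar) 2 P) :
    MemLp (fun ω => stochGrad f (what t ω) (ξ t ω)) 2 P := by
  have h1 : MemLp (fun ω => stochGrad f wstar (ξ t ω)) 2 P :=
    (hg wstar).comp_measurePreserving ⟨h.measurable_sample' t, h.law_sample t⟩
  have h2 : MemLp (fun ω => stochGrad f (what t ω) (ξ t ω) - stochGrad f wstar (ξ t ω)) 2 P :=
    hw.of_le_mul ((h.measurable_stochGrad_sample hm hs hp t).aestronglyMeasurable.sub h1.1)
      (Filter.Eventually.of_forall fun ω => stochGrad_sub_le hs (what t ω) wstar (ξ t ω))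
  have h3 : (fun ω => stochGrad f (what t ω) (ξ t ω))
      = (fun ω => stochGrad f (what t ω) (ξ t ω) - stochGrad f wstar (ξ t ω))
        + fun ω => stochGrad f wstar (ξ t ω) := by
    ext1 ω; simp
  rw [h3]
  exact h2.add h1

theorem memLp_update (h : IsHogwildRun ν f part τ η P ℱ ξ S M w what)
    (hm : ∀ v, Measurable (f v)) (hs : ∀ x, IsLSmooth L (fun v => f v x))
    (hp : IsFilterPartition f D part) (hg : ∀ v, MemLp (stochGrad f v) 2 ν) {t : ℕ}
    (hw : MemLp (fun ω => what t ω - wstar) 2 P) :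
    MemLp (fun ω => hogwildUpdate f part (η t) (ξ t ω) (S t ω) (what t ω)) 2 P :=
  (h.memLp_stochGrad_sample hm hs hp hg hw).of_le_mul
    (h.measurable_update' hm hs hp t).aestronglyMeasurable
    (Filter.Eventually.of_forall fun _ => hp.norm_hogwildUpdate_le _ _ _ _)

theorem memLp_iterate_read (h : IsHogwildRun ν f part τ η P ℱ ξ S M w what)
    (hm : ∀ v, Measurable (f v)) (hs : ∀ x, IsLSmooth L (fun v => f v x))
    (hp : IsFilterPartition f D part) (hg : ∀ v, MemLp (stochGrad f v) 2 ν)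
    (h0 : Integrable (fun ω => ‖w 0 ω - wstar‖ ^ 2) P) (t : ℕ) :
    MemLp (fun ω => w t ω - wstar) 2 P ∧ MemLp (fun ω => what t ω - wstar) 2 P := by
  induction t using Nat.strong_induction_on with
  | _ t ih =>
    have hw : MemLp (fun ω => w t ω - wstar) 2 P := by
      cases t with
      | zero =>
        have h1 : Measurable (w 0) := h.measurable_init.mono (ℱ.le 0) le_rfl
        exact (memLp_two_iff_integrable_sq_norm
          (h1.sub_const wstar).aestronglyMeasurable).2 h0
      | succ t =>
        have e : (fun ω => w (t + 1) ω - wstar) = (fun ω => w t ω - wstar)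
            - fun ω => hogwildUpdate f part (η t) (ξ t ω) (S t ω) (what t ω) := by
          ext1 ω
          rw [h.step t ω, Pi.sub_apply]
          abel
        rw [e]
        obtain ⟨h1, h2⟩ := ih t (Nat.lt_succ_self t)
        exact h1.sub (h.memLp_update hm hs hp hg h2)
    refine ⟨hw, ?_⟩
    have e : (fun ω => what t ω - wstar) = (fun ω => w (t - τ) ω - wstar)
        - fun ω => ∑ j ∈ Finset.Ico (t - τ) t,
          filterVec (M t j ω) (hogwildUpdate f part (η j) (ξ j ω) (S j ω) (what j ω)) := by
      ext1 ω
      rw [h.read t ω, Pi.sub_apply]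
      abel
    rw [e]
    refine MemLp.sub ?_ (memLp_finsetSum _ fun j hj => ?_)
    · rcases Nat.lt_or_eq_of_le (Nat.sub_le t τ) with hlt | heq
      · exact (ih _ hlt).1
      · rw [heq]; exact hw
    · have hjt := (Finset.mem_Ico.1 hj).2
      refine (h.memLp_update hm hs hp hg (ih j hjt).2).mono
        (Measurable.aestronglyMeasurable ?_)
        (Filter.Eventually.of_forall fun ω => norm_filterVec_le _ _)
      exact measurable_filterVec (fun i => ℱ.le t _ (h.measurable_mask t j i))
        (h.measurable_update' hm hs hp j)

/-- The difference is minus the sum of the at most `τ` recent updates restricted to the complements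
of their masks. Masking does not increase norms, so arbitrary masks are allowed; Cauchy–Schwarz
gives the factor `τ`. -/
theorem norm_iterate_sub_read_sq_le (h : IsHogwildRun ν f part τ η P ℱ ξ S M w what)
    (t : ℕ) (ω : Ω) :
    ‖w t ω - what t ω‖ ^ 2 ≤ τ * ∑ j ∈ Finset.Ico (t - τ) t,
      ‖hogwildUpdate f part (η j) (ξ j ω) (S j ω) (what j ω)‖ ^ 2 := by
  set U : ℕ → Vec d := fun j => hogwildUpdate f part (η j) (ξ j ω) (S j ω) (what j ω) with hU
  have h1 : ∀ n : ℕ, w (t - τ + n) ω = w (t - τ) ω - ∑ j ∈ Finset.Ico (t - τ) (t - τ + n), U j := by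
    intro n
    induction n with
    | zero => simp
    | succ n ih =>
      rw [← add_assoc, h.step, ih, Finset.sum_Ico_succ_top (by omega)]
      abel
  have h2 := h1 (t - (t - τ))
  rw [Nat.add_sub_cancel' (Nat.sub_le t τ)] at h2
  have h3 : w t ω - what t ω
      = -∑ j ∈ Finset.Ico (t - τ) t, (U j - filterVec (M t j ω) (U j)) := by
    rw [h.read t ω, h2, Finset.sum_sub_distrib]
    abel
  have hcard : ((Finset.Ico (t - τ) t).card : ℝ) ≤ τ := by
    rw [Nat.card_Ico]; exact_mod_cast (by omega)
  calc ‖w t ω - what t ω‖ ^ 2 ≤ (∑ j ∈ Finset.Ico (t - τ) t, ‖U j‖) ^ 2 := by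
        rw [h3, norm_neg]
        exact pow_le_pow_left₀ (norm_nonneg _) (norm_sum_le_of_le _ fun j _ =>
          norm_sub_filterVec_le _ _) 2
    _ ≤ (Finset.Ico (t - τ) t).card * ∑ j ∈ Finset.Ico (t - τ) t, ‖U j‖ ^ 2 :=
        sq_sum_le_card_mul_sum_sq
    _ ≤ _ := by gcongr

variable [IsProbabilityMeasure P]

theorem integral_norm_update_sq_le (h : IsHogwildRun ν f part τ η P ℱ ξ S M w what)
    (hm : ∀ v, Measurable (f v)) (hs : ∀ x, IsLSmooth L (fun v => f v x))
    (hp : IsFilterPartition f D part) (hg : ∀ v, MemLp (stochGrad f v) 2 ν) {t : ℕ}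
    (hw : MemLp (fun ω => what t ω - wstar) 2 P) :
    Integrable (fun ω => ∫ x, ‖stochGrad f (what t ω) x‖ ^ 2 ∂ν) P ∧
      ∫ ω, ‖hogwildUpdate f part (η t) (ξ t ω) (S t ω) (what t ω)‖ ^ 2 ∂P
        ≤ η t ^ 2 * D * ∫ ω, ∫ x, ‖stochGrad f (what t ω) x‖ ^ 2 ∂ν ∂P := by
  have hwm := (h.measurable_iterate_read hm hs hp t).2
  have hG := h.memLp_stochGrad_sample hm hs hp hg hw
  have hG2 := hG.integrable_norm_pow (p := 2) two_ne_zero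
  have hle : ℱ t ≤ ℱ t ⊔ MeasurableSpace.comap (ξ t) inferInstance := le_sup_left
  have hΦm : ∀ s, Measurable[ℱ t ⊔ MeasurableSpace.comap (ξ t) inferInstance] fun ω =>
      ‖hogwildUpdate f part (η t) (ξ t ω) s (what t ω)‖ ^ 2 := by
    intro s
    have hX : Measurable[ℱ t ⊔ MeasurableSpace.comap (ξ t) inferInstance] (ξ t) :=
      (comap_measurable (ξ t)).mono le_sup_right le_rfl
    have hn : Measurable fun v : Vec d => ‖v‖ ^ 2 := measurable_norm.pow_const 2
    exact hn.comp (hp.measurable_hogwildUpdate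
      (m := ℱ t ⊔ MeasurableSpace.comap (ξ t) inferInstance) (S := fun _ => s) hm hs hX
      (fun i => MeasurableSet.const _) (hwm.mono hle le_rfl) (η t))
  have hΦi : ∀ s, Integrable (fun ω =>
      ‖hogwildUpdate f part (η t) (ξ t ω) s (what t ω)‖ ^ 2) P := by
    intro s
    have : MemLp (fun ω => hogwildUpdate f part (η t) (ξ t ω) s (what t ω)) 2 P := by
      refine hG.of_le_mul ?_
        (Filter.Eventually.of_forall fun ω => hp.norm_hogwildUpdate_le (η t) (ξ t ω) s _)
      exact (hp.measurable_hogwildUpdate (S := fun _ => s) hm hs (h.measurable_sample' t)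
        (fun i => MeasurableSet.const _) (h.measurable_read hm hs hp t)
        (η t)).aestronglyMeasurable
    exact this.integrable_norm_pow (p := 2) two_ne_zero
  obtain ⟨h0, h1⟩ := h.integral_selected t (Φ := fun s ω =>
    ‖hogwildUpdate f part (η t) (ξ t ω) s (what t ω)‖ ^ 2) hΦm hΦi
    (fun ω => by simp [hogwildUpdate])
  have hΨ : Measurable fun p : Vec d × Ξ => ‖stochGrad f p.1 p.2‖ ^ 2 :=
    (measurable_uncurry_stochGrad hm hs).norm.pow_const 2
  obtain ⟨h2, h3⟩ := h.integral_sample t hwm hΨ hG2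
  refine ⟨h2, ?_⟩
  rw [h1, ← h3, ← integral_const_mul]
  exact integral_mono h0 (hG2.const_mul _) fun ω =>
    hp.sum_parts_norm_hogwildUpdate_sq_le (η t) (ξ t ω) (what t ω)

variable [IsProbabilityMeasure ν]

theorem integral_inner_update (h : IsHogwildRun ν f part τ η P ℱ ξ S M w what)
    (hm : ∀ v, Measurable (f v)) (hs : ∀ x, IsLSmooth L (fun v => f v x))
    (hp : IsFilterPartition f D part) (hg : ∀ v, MemLp (stochGrad f v) 2 ν) {t : ℕ}
    (hw : MemLp (fun ω => what t ω - wstar) 2 P) {W : Ω → Vec d} (hWm : Measurable[ℱ t] W)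
    (hW : MemLp W 2 P) :
    Integrable (fun ω => inner ℝ (∫ x, stochGrad f (what t ω) x ∂ν) (W ω)) P ∧
      ∫ ω, inner ℝ (hogwildUpdate f part (η t) (ξ t ω) (S t ω) (what t ω)) (W ω) ∂P
        = η t * ∫ ω, inner ℝ (∫ x, stochGrad f (what t ω) x ∂ν) (W ω) ∂P := by
  have hwm := (h.measurable_iterate_read hm hs hp t).2
  have hG := h.memLp_stochGrad_sample hm hs hp hg hw
  have hle : ℱ t ≤ ℱ t ⊔ MeasurableSpace.comap (ξ t) inferInstance := le_sup_left
  have hΦm : ∀ s, Measurable[ℱ t ⊔ MeasurableSpace.comap (ξ t) inferInstance] fun ω =>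
      (inner ℝ (hogwildUpdate f part (η t) (ξ t ω) s (what t ω)) (W ω) : ℝ) := by
    intro s
    have hX : Measurable[ℱ t ⊔ MeasurableSpace.comap (ξ t) inferInstance] (ξ t) :=
      (comap_measurable (ξ t)).mono le_sup_right le_rfl
    exact (hp.measurable_hogwildUpdate
      (m := ℱ t ⊔ MeasurableSpace.comap (ξ t) inferInstance) (S := fun _ => s) hm hs hX
      (fun i => MeasurableSet.const _) (hwm.mono hle le_rfl) (η t)).inner (hWm.mono hle le_rfl)
  have hΦi : ∀ s, Integrable (fun ω =>
      (inner ℝ (hogwildUpdate f part (η t) (ξ t ω) s (what t ω)) (W ω) : ℝ)) P := by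
    intro s
    refine integrable_inner_of_memLp (hG.of_le_mul ?_
      (Filter.Eventually.of_forall fun ω => hp.norm_hogwildUpdate_le (η t) (ξ t ω) s _)) hW
    exact (hp.measurable_hogwildUpdate (S := fun _ => s) hm hs (h.measurable_sample' t)
      (fun i => MeasurableSet.const _) (h.measurable_read hm hs hp t) (η t)).aestronglyMeasurable
  obtain ⟨-, h1⟩ := h.integral_selected t (Φ := fun s ω =>
    (inner ℝ (hogwildUpdate f part (η t) (ξ t ω) s (what t ω)) (W ω) : ℝ)) hΦm hΦi
    (fun ω => by simp [hogwildUpdate])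
  simp_rw [sum_parts_inner_hogwildUpdate] at h1
  have hΨ : Measurable fun p : (Vec d × Vec d) × Ξ => (inner ℝ (stochGrad f p.1.1 p.2) p.1.2 : ℝ) :=
    ((measurable_uncurry_stochGrad hm hs).comp (measurable_fst.fst.prodMk measurable_snd)).inner
      measurable_fst.snd
  -- Read and test vector are frozen jointly, as both are known before the sample is drawn.
  obtain ⟨h2, h3⟩ := h.integral_sample t (V := fun ω => (what t ω, W ω)) (hwm.prodMk hWm) hΨ
    (integrable_inner_of_memLp hG hW)
  have e : ∀ v u : Vec d, ∫ x, inner ℝ (stochGrad f v x) u ∂ν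
      = inner ℝ (∫ x, stochGrad f v x ∂ν) u := by
    intro v u
    simp_rw [real_inner_comm u]
    exact integral_inner ((hg v).integrable (by norm_num)) u
  simp_rw [e] at h2 h3
  refine ⟨h2, ?_⟩
  rw [h1, integral_const_mul, h3]

end IsHogwildRun

/-! ### Expected filter size, and the recursion for the second moments. -/

namespace IsHogwildRun

variable {d : ℕ} {Ξ : Type u} [MeasurableSpace Ξ] {ν : Measure Ξ}
  {f : Vec d → Ξ → ℝ} {part : (ξ : Ξ) → Finpartition (gradSupport f ξ)} {τ : ℕ}
  {Ω : Type v} [mΩ : MeasurableSpace Ω] {P : Measure Ω} [IsProbabilityMeasure P]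
  {ℱ : Filtration ℕ mΩ} {ξ : ℕ → Ω → Ξ} {S : ℕ → Ω → Finset (Fin d)}
  {M : ℕ → ℕ → Ω → Finset (Fin d)} {w what : ℕ → Ω → Vec d} {D : ℕ} {wstar : Vec d}

theorem integral_card_filter {η : ℕ → ℝ} (h : IsHogwildRun ν f part τ η P ℱ ξ S M w what)
    (hp : IsFilterPartition f D part) (t : ℕ) :
    ∫ ω, ((S t ω).card : ℝ) ∂P
      = ∫ x, ((gradSupport f x).card : ℝ) / (min D (gradSupport f x).card : ℕ) ∂ν := by
  obtain ⟨-, h1⟩ := h.integral_selected t (Φ := fun s _ => (s.card : ℝ))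
    (fun _ => measurable_const) (fun _ => integrable_const _) (fun _ => by simp)
  rw [h1, ← h.law_sample t]
  have hmeas : Measurable fun x =>
      ((gradSupport f x).card : ℝ) / (min D (gradSupport f x).card : ℕ) :=
    (Measurable.of_discrete (f := fun n : ℕ => (n : ℝ) / (min D n : ℕ))).comp
      hp.measurable_card_gradSupport
  rw [integral_map (h.measurable_sample' t).aemeasurable hmeas.aestronglyMeasurable]
  congr 1
  ext ω
  rw [← Finset.mul_sum, ← Nat.cast_sum, (part (ξ t ω)).sum_card_parts, hp.card_parts,
    div_eq_inv_mul]

theorem integrable_card_filter {η : ℕ → ℝ} (h : IsHogwildRun ν f part τ η P ℱ ξ S M w what)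
    (t : ℕ) : Integrable (fun ω => ((S t ω).card : ℝ)) P := by
  have e : (fun ω => ((S t ω).card : ℝ))
      = fun ω => ∑ i, Set.indicator {ω | i ∈ S t ω} (fun _ => (1 : ℝ)) ω := by
    ext ω
    simp [Set.indicator]
  rw [e]
  exact integrable_finsetSum _ fun i _ =>
    (integrable_const _).indicator (ℱ.le _ _ (h.measurable_filter t i))

variable [IsProbabilityMeasure ν]

theorem integral_norm_update_sq_le' {L : ℝ} {η : ℕ → ℝ}
    (h : IsHogwildRun ν f part τ η P ℱ ξ S M w what)
    (hm : ∀ v, Measurable (f v)) (hs : ∀ x, IsLSmooth L (fun v => f v x))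
    (hp : IsFilterPartition f D part) (hg : ∀ v, MemLp (stochGrad f v) 2 ν) {t : ℕ}
    (hw : MemLp (fun ω => what t ω - wstar) 2 P) :
    ∫ ω, ‖hogwildUpdate f part (η t) (ξ t ω) (S t ω) (what t ω)‖ ^ 2 ∂P
      ≤ η t ^ 2 * (D * (2 * L ^ 2 * ∫ ω, ‖what t ω - wstar‖ ^ 2 ∂P
        + 2 * ∫ x, ‖stochGrad f wstar x‖ ^ 2 ∂ν)) := by
  obtain ⟨h1, h2⟩ := h.integral_norm_update_sq_le hm hs hp hg hw
  have hw2 := hw.integrable_norm_pow (p := 2) two_ne_zero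
  refine h2.trans ?_
  rw [mul_assoc]
  gcongr
  calc ∫ ω, ∫ x, ‖stochGrad f (what t ω) x‖ ^ 2 ∂ν ∂P
      ≤ ∫ ω, (2 * L ^ 2 * ‖what t ω - wstar‖ ^ 2
          + 2 * ∫ x, ‖stochGrad f wstar x‖ ^ 2 ∂ν) ∂P :=
        integral_mono h1 ((hw2.const_mul _).add (integrable_const _)) fun ω =>
          integral_norm_stochGrad_sq_le hs hg (what t ω) wstar
    _ = _ := by
        rw [integral_add (hw2.const_mul _) (integrable_const _), integral_const_mul,
          integral_const]
        simp

/-- The second moments of the iterates and of the read vectors satisfy a delayed recursion. -/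
theorem isDelayedRecursion {L μ α N R E : ℝ} {a : ℕ → ℝ} (hL : 0 < L) (hμ : 0 < μ) (hE : 0 < E)
    (hE' : 4 * L * α * D / μ ≤ E) (ha : ∀ t, 4 ≤ a t ∧ a t ≤ α)
    (h : IsHogwildRun ν f part τ (fun t => a t / (μ * (t + E))) P ℱ ξ S M w what)
    (hm : ∀ v, Measurable (f v)) (hi : ∀ v, Integrable (f v) ν)
    (hF : IsFirstOrderConvex μ (risk ν f)) (hs : ∀ x, IsLSmooth L (fun v => f v x))
    (hc : ∀ x, IsFirstOrderConvex 0 (fun v => f v x))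
    (hmin : ∀ v, risk ν f wstar ≤ risk ν f v)
    (hp : IsFilterPartition f D part) (hg : ∀ v, MemLp (stochGrad f v) 2 ν)
    (hN : N = 2 * ∫ x, ‖stochGrad f wstar x‖ ^ 2 ∂ν)
    (h0 : Integrable (fun ω => ‖w 0 ω - wstar‖ ^ 2) P)
    (hR : ∫ ω, ‖w 0 ω - wstar‖ ^ 2 ∂P ≤ R) :
    IsDelayedRecursion E R ((α / μ) ^ 2 * D * N) ((2 * L + μ) * (α / μ))
      (τ * (α / μ) ^ 2 * D * (2 * L ^ 2)) (τ * (α / μ) ^ 2 * D * N)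
      (2 * (α / μ / E) ^ 2 * D * (2 * L ^ 2)) (2 * (α / μ / E) ^ 2 * D * N) τ
      (fun t => ∫ ω, ‖w t ω - wstar‖ ^ 2 ∂P) (fun t => ∫ ω, ‖what t ω - wstar‖ ^ 2 ∂P)
      (fun t => ∫ ω, ‖w t ω - what t ω‖ ^ 2 ∂P) := by
  have hmem := h.memLp_iterate_read hm hs hp hg h0
  have hα : 0 < α := by linarith [(ha 0).1, (ha 0).2]
  have hN0 : 0 ≤ N := by
    rw [hN]; exact mul_nonneg zero_le_two (integral_nonneg fun x => by positivity)
  have hYi : ∀ t, Integrable (fun ω => ‖w t ω - wstar‖ ^ 2) P := fun t =>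
    (hmem t).1.integrable_norm_pow (p := 2) two_ne_zero
  have hZi : ∀ t, Integrable (fun ω => ‖what t ω - wstar‖ ^ 2) P := fun t =>
    (hmem t).2.integrable_norm_pow (p := 2) two_ne_zero
  have hXi : ∀ t, Integrable (fun ω => ‖w t ω - what t ω‖ ^ 2) P := fun t => by
    have e : (fun ω => w t ω - what t ω)
        = (fun ω => w t ω - wstar) - fun ω => what t ω - wstar := by ext1 ω; simp
    have h1 : MemLp (fun ω => w t ω - what t ω) 2 P := by
      rw [e]; exact (hmem t).1.sub (hmem t).2
    exact h1.integrable_norm_pow (p := 2) two_ne_zero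
  let U : ℕ → Ω → Vec d := fun t ω =>
    hogwildUpdate f part (a t / (μ * (t + E))) (ξ t ω) (S t ω) (what t ω)
  have hU : ∀ t, MemLp (U t) 2 P := fun t => h.memLp_update hm hs hp hg (hmem t).2
  have hUi : ∀ t, Integrable (fun ω => ‖U t ω‖ ^ 2) P := fun t =>
    (hU t).integrable_norm_pow (p := 2) two_ne_zero
  have hpos : ∀ t : ℕ, 0 < (t : ℝ) + E := fun t => by positivity
  have hη0 : ∀ t : ℕ, 0 ≤ a t / (μ * (t + E)) := fun t =>
    div_nonneg (by linarith [(ha t).1]) (mul_pos hμ (hpos t)).le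
  have hηle : ∀ t : ℕ, a t / (μ * (t + E)) ≤ α / μ / (t + E) := fun t => by
    rw [div_div]
    exact div_le_div_of_nonneg_right (ha t).2 (mul_pos hμ (hpos t)).le
  -- The condition `4 ≤ α_t` enters here: it turns the decay `η * μ / 2` into `2 / (t + E)`, as the
  -- telescoping requires.
  have hηge : ∀ t : ℕ, 2 / ((t : ℝ) + E) ≤ μ / 2 * (a t / (μ * (t + E))) := fun t => by
    have e : μ / 2 * (a t / (μ * (t + E))) = (a t / 2) / (t + E) := by
      have := (hpos t).ne'
      field_simp
    rw [e]
    exact div_le_div_of_nonneg_right (by linarith [(ha t).1]) (hpos t).le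
  have hUle : ∀ t, ∫ ω, ‖U t ω‖ ^ 2 ∂P ≤ (a t / (μ * (t + E))) ^ 2 *
      (D * (2 * L ^ 2 * ∫ ω, ‖what t ω - wstar‖ ^ 2 ∂P + N)) := fun t => by
    rw [hN]; exact h.integral_norm_update_sq_le' hm hs hp hg (hmem t).2
  have hZ0 : ∀ t, 0 ≤ D * (2 * L ^ 2 * ∫ ω, ‖what t ω - wstar‖ ^ 2 ∂P + N) := fun t => by
    have : 0 ≤ ∫ ω, ‖what t ω - wstar‖ ^ 2 ∂P := integral_nonneg fun ω => by positivity
    positivity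
  have hstep : ∀ t ω, w (t + 1) ω - wstar = (w t ω - wstar) - U t ω := fun t ω => by
    rw [h.step t ω]; abel
  refine ⟨fun t => integral_nonneg fun ω => by positivity, hR, fun t => ?_, fun t => ?_,
    fun t => ?_, fun t => ?_⟩
  · calc ∫ ω, ‖w (t + 1) ω - wstar‖ ^ 2 ∂P
        ≤ ∫ ω, (2 * ‖w t ω - wstar‖ ^ 2 + 2 * ‖U t ω‖ ^ 2) ∂P := by
          refine integral_mono (hYi _) (((hYi t).const_mul 2).add ((hUi t).const_mul 2)) fun ω => ?_
          dsimp only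
          rw [hstep]
          have h1 := pow_le_pow_left₀ (norm_nonneg _) (norm_sub_le (w t ω - wstar) (U t ω)) 2
          nlinarith [sq_nonneg (‖w t ω - wstar‖ - ‖U t ω‖)]
      _ = 2 * ∫ ω, ‖w t ω - wstar‖ ^ 2 ∂P + 2 * ∫ ω, ‖U t ω‖ ^ 2 ∂P := by
          rw [integral_add ((hYi t).const_mul 2) ((hUi t).const_mul 2), integral_const_mul,
            integral_const_mul]
      _ ≤ 2 * ∫ ω, ‖w t ω - wstar‖ ^ 2 ∂P + 2 * ((α / μ / E) ^ 2 *
            (D * (2 * L ^ 2 * ∫ ω, ‖what t ω - wstar‖ ^ 2 ∂P + N))) := by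
          have h1 : a t / (μ * (t + E)) ≤ α / μ / E := by
            refine (hηle t).trans ?_
            have : E ≤ t + E := by simp
            gcongr
          have h2 := mul_le_mul_of_nonneg_right (pow_le_pow_left₀ (hη0 t) h1 2) (hZ0 t)
          linarith [hUle t]
      _ = _ := by ring
  · calc ∫ ω, ‖what t ω - wstar‖ ^ 2 ∂P
        ≤ ∫ ω, (2 * ‖w t ω - wstar‖ ^ 2 + 2 * ‖w t ω - what t ω‖ ^ 2) ∂P := by
          refine integral_mono (hZi _) (((hYi t).const_mul 2).add ((hXi t).const_mul 2)) fun ω => ?_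
          dsimp only
          have h1 : ‖what t ω - wstar‖ ≤ ‖w t ω - what t ω‖ + ‖w t ω - wstar‖ := by
            rw [norm_sub_rev (w t ω) (what t ω)]
            exact norm_sub_le_norm_sub_add_norm_sub _ _ _
          have h2 := pow_le_pow_left₀ (norm_nonneg _) h1 2
          nlinarith [sq_nonneg (‖w t ω - wstar‖ - ‖w t ω - what t ω‖)]
      _ = _ := by
          rw [integral_add ((hYi t).const_mul 2) ((hXi t).const_mul 2), integral_const_mul,
            integral_const_mul]
  · calc ∫ ω, ‖w t ω - what t ω‖ ^ 2 ∂P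
        ≤ ∫ ω, τ * ∑ j ∈ Finset.Ico (t - τ) t, ‖U j ω‖ ^ 2 ∂P :=
          integral_mono (hXi t) ((integrable_finsetSum _ fun j _ => hUi j).const_mul _)
            fun ω => h.norm_iterate_sub_read_sq_le t ω
      _ = ∑ j ∈ Finset.Ico (t - τ) t, τ * ∫ ω, ‖U j ω‖ ^ 2 ∂P := by
          rw [integral_const_mul, integral_finsetSum _ fun j _ => hUi j, Finset.mul_sum]
      _ ≤ _ := by
          refine Finset.sum_le_sum fun j _ => ?_
          have h2 := mul_le_mul_of_nonneg_right (pow_le_pow_left₀ (hη0 j) (hηle j) 2) (hZ0 j)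
          have h3 := mul_le_mul_of_nonneg_left ((hUle j).trans h2) (Nat.cast_nonneg (α := ℝ) τ)
          refine h3.trans (le_of_eq ?_)
          rw [div_pow]
          ring
  -- The second entry in the maximum defining `E` is exactly what makes the step size small enough
  -- for the descent inequality.
  · have hηE : 4 * L * D * (a t / (μ * (t + E))) ≤ 1 := by
      calc 4 * L * D * (a t / (μ * (t + E))) ≤ 4 * L * D * (α / μ / (t + E)) := by
            exact mul_le_mul_of_nonneg_left (hηle t) (by positivity)
        _ = (4 * L * α * D / μ) / (t + E) := by ring
        _ ≤ 1 := by
            rw [div_le_one (hpos t)]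
            have : (0 : ℝ) ≤ t := t.cast_nonneg
            linarith
    have hWm : Measurable[ℱ t] fun ω => w t ω - wstar :=
      (h.measurable_iterate_read hm hs hp t).1.sub_const wstar
    obtain ⟨hI, hIeq⟩ := h.integral_inner_update hm hs hp hg (hmem t).2 hWm (hmem t).1
    obtain ⟨hΨ, hΨle⟩ := h.integral_norm_update_sq_le hm hs hp hg (hmem t).2
    change ∫ ω, inner ℝ (U t ω) (w t ω - wstar) ∂P = _ at hIeq
    change ∫ ω, ‖U t ω‖ ^ 2 ∂P ≤ _ at hΨle
    have hUW : Integrable (fun ω => (inner ℝ (U t ω) (w t ω - wstar) : ℝ)) P :=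
      integrable_inner_of_memLp (hU t) (hmem t).1
    have hsq : ∫ ω, ‖w (t + 1) ω - wstar‖ ^ 2 ∂P = ∫ ω, ‖w t ω - wstar‖ ^ 2 ∂P
        - 2 * ∫ ω, inner ℝ (U t ω) (w t ω - wstar) ∂P + ∫ ω, ‖U t ω‖ ^ 2 ∂P := by
      have hsub : Integrable (fun ω => ‖w t ω - wstar‖ ^ 2
          - 2 * inner ℝ (U t ω) (w t ω - wstar)) P := (hYi t).sub (hUW.const_mul 2)
      rw [← integral_const_mul, ← integral_sub (hYi t) (hUW.const_mul 2),
        ← integral_add hsub (hUi t)]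
      refine integral_congr_ae (Filter.Eventually.of_forall fun ω => ?_)
      dsimp only
      rw [hstep, norm_sub_sq_real, real_inner_comm]
    set η := a t / (μ * (t + E)) with hη
    have hdesc : -2 * ∫ ω, inner ℝ (∫ x, stochGrad f (what t ω) x ∂ν) (w t ω - wstar) ∂P
          + η * D * ∫ ω, ∫ x, ‖stochGrad f (what t ω) x‖ ^ 2 ∂ν ∂P
        ≤ -(μ / 2) * ∫ ω, ‖w t ω - wstar‖ ^ 2 ∂P
          + (2 * L + μ) * ∫ ω, ‖w t ω - what t ω‖ ^ 2 ∂P + η * D * N := by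
      have hadd : Integrable (fun ω => -(μ / 2) * ‖w t ω - wstar‖ ^ 2
          + (2 * L + μ) * ‖w t ω - what t ω‖ ^ 2) P :=
        ((hYi t).const_mul (-(μ / 2))).add ((hXi t).const_mul (2 * L + μ))
      have hmono := integral_mono ((hI.const_mul (-2)).add (hΨ.const_mul (η * D)))
        (hadd.add (integrable_const (η * D * N))) (fun ω => by
            rw [hN]
            exact descent_inequality hL hμ hi hF hs hc hg hmin (hη0 t) D.cast_nonneg hηE
              (what t ω) (w t ω))
      simp only [Pi.add_apply] at hmono
      rw [integral_add (hI.const_mul (-2)) (hΨ.const_mul (η * D)),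
        integral_add hadd (integrable_const (η * D * N)),
        integral_add ((hYi t).const_mul (-(μ / 2))) ((hXi t).const_mul (2 * L + μ)),
        integral_const_mul, integral_const_mul, integral_const_mul, integral_const_mul,
        integral_const] at hmono
      simpa using hmono
    have hdesc' := mul_le_mul_of_nonneg_left hdesc (hη0 t)
    have hY0 : 0 ≤ ∫ ω, ‖w t ω - wstar‖ ^ 2 ∂P := integral_nonneg fun ω => by positivity
    have hX0 : 0 ≤ ∫ ω, ‖w t ω - what t ω‖ ^ 2 ∂P := integral_nonneg fun ω => by positivity
    beta_reduce
    rw [hsq, hIeq]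
    have b1 := mul_le_mul_of_nonneg_right (hηge t) hY0
    have b2 := mul_le_mul_of_nonneg_right (hηle t) (mul_nonneg (by positivity : 0 ≤ 2 * L + μ) hX0)
    have b3 := mul_le_mul_of_nonneg_right (pow_le_pow_left₀ (hη0 t) (hηle t) 2)
      (mul_nonneg D.cast_nonneg hN0 : 0 ≤ (D : ℝ) * N)
    rw [← hη] at b1 b2 b3
    generalize (∫ ω, ‖w t ω - wstar‖ ^ 2 ∂P) = Y at *
    generalize (∫ ω, ‖w t ω - what t ω‖ ^ 2 ∂P) = X at *
    generalize (∫ ω, ∫ x, ‖stochGrad f (what t ω) x‖ ^ 2 ∂ν ∂P) = Ψ at *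
    generalize (∫ ω, inner ℝ (∫ x, stochGrad f (what t ω) x ∂ν) (w t ω - wstar) ∂P) = I at *
    have e1 : (2 * L + μ) * (α / μ) / (t + E) * X = α / μ / (t + E) * ((2 * L + μ) * X) := by ring
    have e2 : (α / μ) ^ 2 * D * N / (t + E) ^ 2 = (α / μ / (t + E)) ^ 2 * (D * N) := by
      rw [div_pow (α / μ)]; ring
    rw [e1, e2]
    linarith

end IsHogwildRun

/-! ### Arithmetic of the update count. -/

theorem div_min_le_ceil {D : ℕ} (hD : 1 ≤ D) (n : ℕ) :
    (n : ℝ) / (min D n : ℕ) ≤ (⌈(n : ℝ) / D⌉₊ : ℝ) := by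
  rcases le_total D n with h | h
  · rw [min_eq_left h]
    exact Nat.le_ceil _
  · rw [min_eq_right h]
    rcases Nat.eq_zero_or_pos n with rfl | hn
    · simp
    · rw [div_self (by positivity)]
      exact_mod_cast Nat.one_le_ceil_iff.2 (by positivity)

theorem div_min_eq_ceil_iff {D : ℕ} (hD : 1 ≤ D) (n : ℕ) :
    (n : ℝ) / (min D n : ℕ) = (⌈(n : ℝ) / D⌉₊ : ℝ) ↔ n ≤ D ∨ D ∣ n := by
  have hD0 : (0 : ℝ) < D := by exact_mod_cast hD
  constructor
  · intro h
    rcases le_total n D with hn | hn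
    · exact Or.inl hn
    · right
      rw [min_eq_left hn, div_eq_iff hD0.ne'] at h
      exact ⟨⌈(n : ℝ) / D⌉₊, by rw [mul_comm]; exact_mod_cast h⟩
  · rintro (h | ⟨k, rfl⟩)
    · rw [min_eq_right h]
      rcases Nat.eq_zero_or_pos n with rfl | hn
      · simp
      · rw [div_self (by positivity)]
        have h1 : ⌈(n : ℝ) / D⌉₊ ≤ 1 := by
          rw [Nat.ceil_le, Nat.cast_one, div_le_one hD0]
          exact_mod_cast h
        have h2 : 1 ≤ ⌈(n : ℝ) / D⌉₊ := Nat.one_le_ceil_iff.2 (by positivity)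
        exact_mod_cast le_antisymm h2 h1
    · have e : ((D * k : ℕ) : ℝ) / D = k := by push_cast; field_simp
      rw [e, Nat.ceil_natCast]
      rcases Nat.eq_zero_or_pos k with rfl | hk
      · simp
      · rw [min_eq_left (Nat.le_mul_of_pos_right D hk), e]

theorem IsFilterPartition.integrable_comp_card {d : ℕ} {Ξ : Type u} [MeasurableSpace Ξ]
    {ν : Measure Ξ} [IsFiniteMeasure ν] {f : Vec d → Ξ → ℝ} {D : ℕ}
    {part : (ξ : Ξ) → Finpartition (gradSupport f ξ)} (hp : IsFilterPartition f D part)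
    (q : ℕ → ℝ) : Integrable (fun x => q (gradSupport f x).card) ν := by
  refine Integrable.of_bound (C := ∑ n ∈ Finset.range (d + 1), ‖q n‖)
    ((Measurable.of_discrete (f := q)).comp hp.measurable_card_gradSupport).aestronglyMeasurable
    (Filter.Eventually.of_forall fun x => ?_)
  refine Finset.single_le_sum (f := fun n => ‖q n‖) (fun _ _ => norm_nonneg _)
    (Finset.mem_range.2 (Nat.lt_succ_of_le ?_))
  simpa using (gradSupport f x).card_le_univ

/-! ### The main theorem. -/

theorem theorem5 (μ L α N R : ℝ) (D τ : ℕ) (hμ : 0 < μ) (hL : 0 < L) (hD : 1 ≤ D) :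
    -- the constant of the `O`-term depends only on `μ, L, α, N, R, D, τ`
    ∃ C : ℝ, ∀ (d : ℕ) (Ξ : Type u) [MeasurableSpace Ξ] (ν : Measure Ξ) [IsProbabilityMeasure ν]
      (f : Vec d → Ξ → ℝ) (wstar : Vec d)
      (Ω : Type v) [mΩ : MeasurableSpace Ω] (P : Measure Ω) [IsProbabilityMeasure P]
      (ℱ : Filtration ℕ mΩ) (part : (ξ : Ξ) → Finpartition (gradSupport f ξ)) (a : ℕ → ℝ)
      (ξ : ℕ → Ω → Ξ) (S : ℕ → Ω → Finset (Fin d)) (M : ℕ → ℕ → Ω → Finset (Fin d))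
      (w what : ℕ → Ω → Vec d),
      -- the problem: `F = risk ν f` is well defined and strongly convex with minimizer `wstar`,
      -- each `f(·;ξ)` is smooth and convex, and `N = 2 𝔼‖∇f(wstar;ξ)‖²` is finite
      (∀ v, Measurable (f v)) → (∀ v, Integrable (f v) ν) →
      IsFirstOrderConvex μ (risk ν f) →
      (∀ x, IsLSmooth L (fun v => f v x)) →
      (∀ x, IsFirstOrderConvex 0 (fun v => f v x)) →
      (∀ v, risk ν f wstar ≤ risk ν f v) →
      Integrable (fun x => ‖stochGrad f wstar x‖ ^ 2) ν →
      N = 2 * ∫ x, ‖stochGrad f wstar x‖ ^ 2 ∂ν →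
      -- the algorithm with parameter `D`, delay `τ` and step sizes `η_t = α_t / (μ (t + E))`
      IsFilterPartition f D part →
      (∀ t, 4 ≤ a t ∧ a t ≤ α) →
      IsHogwildRun ν f part τ (fun t => a t / (μ * (t + stepShift μ L α D τ))) P ℱ ξ S M w what →
      Integrable (fun ω => ‖w 0 ω - wstar‖ ^ 2) P →
      ∫ ω, ‖w 0 ω - wstar‖ ^ 2 ∂P ≤ R →
      -- convergence rate
      (∀ t, Integrable (fun ω => ‖what t ω - wstar‖ ^ 2) P ∧
        Integrable (fun ω => ‖w t ω - wstar‖ ^ 2) P) ∧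
      (∀ t : ℕ, 2 ≤ t →
        ∫ ω, ‖what t ω - wstar‖ ^ 2 ∂P ≤ hogwildBound μ L α N D τ C t ∧
        ∫ ω, ‖w t ω - wstar‖ ^ 2 ∂P ≤ hogwildBound μ L α N D τ C t) ∧
      -- expected number of single vector entry updates after `t` iterations
      (∀ t : ℕ,
        ∫ ω, (∑ j ∈ Finset.range t, ((S j ω).card : ℝ)) ∂P
          = t * ∫ x, ((gradSupport f x).card : ℝ) / (min D (gradSupport f x).card : ℕ) ∂ν ∧
        ∫ ω, (∑ j ∈ Finset.range t, ((S j ω).card : ℝ)) ∂P ≤ t * deltaBar ν f D / D ∧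
        (1 ≤ t →
          (∫ ω, (∑ j ∈ Finset.range t, ((S j ω).card : ℝ)) ∂P = t * deltaBar ν f D / D ↔
            ∀ᵐ x ∂ν, (gradSupport f x).card ≤ D ∨ D ∣ (gradSupport f x).card))) := by
  -- `C` is fixed before the data. If a sign condition fails, no data satisfy the hypotheses and any
  -- `C` works.
  by_cases hcon : 4 ≤ α ∧ 0 ≤ N ∧ 0 ≤ R
  swap
  · refine ⟨0, ?_⟩
    intro d Ξ _ ν _ f wstar Ω _ P _ ℱ part a ξ S M w what _ _ _ _ _ _ _ hN _ ha _ _ hR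
    refine absurd ⟨(ha 0).1.trans (ha 0).2, ?_, ?_⟩ hcon
    · rw [hN]
      exact mul_nonneg zero_le_two (integral_nonneg fun x => by positivity)
    · exact (integral_nonneg fun ω => by positivity).trans hR
  obtain ⟨hα, hN0, hR0⟩ := hcon
  have hD0 : (0 : ℝ) < D := by exact_mod_cast hD
  have hE2 : 2 * (τ : ℝ) ≤ stepShift μ L α D τ := le_max_left _ _
  have hE4 : 4 * L * α * D / μ ≤ stepShift μ L α D τ := le_max_right _ _
  have hE : 0 < stepShift μ L α D τ := lt_of_lt_of_le (by positivity) hE4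
  obtain ⟨C, hC⟩ := IsDelayedRecursion.exists_rate (E := stepShift μ L α D τ) (R := R)
    (A := (α / μ) ^ 2 * D * N) (c₁ := (2 * L + μ) * (α / μ))
    (c₂ := τ * (α / μ) ^ 2 * D * (2 * L ^ 2)) (c₃ := τ * (α / μ) ^ 2 * D * N)
    (c₄ := 2 * (α / μ / stepShift μ L α D τ) ^ 2 * D * (2 * L ^ 2))
    (c₅ := 2 * (α / μ / stepShift μ L α D τ) ^ 2 * D * N) (τ := τ) hE hE2 hR0
    (by positivity) (by positivity) (by positivity) (by positivity) (by positivity)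
    (by positivity)
  refine ⟨C, ?_⟩
  intro d Ξ _ ν _ f wstar Ω _ P _ ℱ part a ξ S M w what hm hi hF hs hc hmin hgi hN hp ha h h0 hR
  have hg := memLp_stochGrad hm hs hgi
  have hmem := h.memLp_iterate_read hm hs hp hg h0
  refine ⟨fun t => ⟨(hmem t).2.integrable_norm_pow (p := 2) two_ne_zero,
    (hmem t).1.integrable_norm_pow (p := 2) two_ne_zero⟩, fun t ht => ?_, fun t => ?_⟩
  · have hrec := h.isDelayedRecursion hL hμ hE hE4 ha hm hi hF hs hc hmin hp hg hN h0 hR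
    obtain ⟨h1, h2⟩ := hC _ _ _ hrec t ht
    have e : 4 * α ^ 2 * D * N / μ ^ 2 = 4 * ((α / μ) ^ 2 * D * N) := by
      rw [div_pow]; ring
    rw [hogwildBound, e]
    exact ⟨h2, h1⟩
  · have hcount : ∫ ω, (∑ j ∈ Finset.range t, ((S j ω).card : ℝ)) ∂P
        = t * ∫ x, ((gradSupport f x).card : ℝ) / (min D (gradSupport f x).card : ℕ) ∂ν := by
      rw [integral_finsetSum _ fun j _ => h.integrable_card_filter j,
        Finset.sum_congr rfl fun j _ => h.integral_card_filter hp j]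
      simp
    have hdelta : t * deltaBar ν f D / D
        = t * ∫ x, (⌈((gradSupport f x).card : ℝ) / D⌉₊ : ℝ) ∂ν := by
      rw [deltaBar]; field_simp
    have hq := hp.integrable_comp_card (ν := ν) fun n => (n : ℝ) / (min D n : ℕ)
    have hr := hp.integrable_comp_card (ν := ν) fun n => (⌈(n : ℝ) / D⌉₊ : ℝ)
    have hqr := fun x => div_min_le_ceil hD (gradSupport f x).card
    rw [hcount, hdelta]
    refine ⟨rfl, mul_le_mul_of_nonneg_left (integral_mono hq hr hqr) t.cast_nonneg, fun ht => ?_⟩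
    have ht' : (t : ℝ) ≠ 0 := by exact_mod_cast (by omega : t ≠ 0)
    -- For ordered integrable functions, equal integrals mean equality almost everywhere.
    rw [mul_right_inj' ht', integral_eq_iff_of_ae_le hq hr (Filter.Eventually.of_forall hqr)]
    exact Filter.eventually_congr (Filter.Eventually.of_forall fun x => div_min_eq_ceil_iff hD _)
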